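/- **Sample complexity of MMD-$k$, given prior information.** *Setting.* A uniform pure $N$-state ensemble ($N\ge 1$) is a family $E=(\psi_i)_{i=1}^N$ of unit vectors of $\mathbb{C}^d$, each drawn with probability $1/N$. For such ensembles put $$\bar F^{(k)}(E,E')=\frac1{N^2}\sum_{i,j=1}^N|\langle\psi_i|\psi'_j\rangle|^{2k},\qquad \mathcal D^{(k)}(E_1,E_2)=\bar F^{(k)}(E_1,E_1)+\bar F^{(k)}(E_2,E_2)-2\bar F^{(k)}(E_1,E_2).$$ The states of $E$ are divided uniformly into $n$ $\varepsilon$-balls of radius $\epsilon_b\ge 0$ if there are central states $\tilde\psi_1,\dots,\tilde\psi_n$ and a map $g:\{1,\dots,N\}\to\{1,\dots,n\}$ with $1-|\langle\psi_i|\tilde\psi_{g(i)}\rangle|^2\le\epsilon_b$ for all $i$ and with every fibre of $g$ of size $N/n$. The map $g$ is the prior information. *Samples and estimator.* A sample for a pair $(E,E')$ with maps $(g,g')$ is obtained by drawing $i,j$ independently and uniformly, running a SWAP test on $\psi_i,\psi'_j$, and recording the label $\ell=(g(i),g'(j))\in\{1,\dots,n\}^2$ together with $R=+1$ if the ancilla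 is found in $|0\rangle$ and $R=-1$ otherwise. From $r$ independent samples $(R_t,\ell_t)_{t=1}^r$ let $T_\ell$ be the number of $t$ with $\ell_t=\ell$, let $$Z_\ell=\binom{T_\ell}{k}^{-1}\sum_{t_1<\dots<t_k,\ \ell_{t_1}=\dots=\ell_{t_k}=\ell}R_{t_1}\cdots R_{t_k}\quad(T_\ell\ge k),\qquad \widehat{F}=\frac1m\sum_{\ell:T_\ell\ge k}Z_\ell,\quad m=\#\{\ell:T_\ell\ge k\},$$ with $\widehat F=0$ if $m=0$. With $M$ samples in total, $\lfloor M/3\rfloor$ independent samples are used for each of the pairs $(E_1,E_1)$, $(E_2,E_2)$, $(E_1,E_2)$, and $\widehat{\mathcal D}^{(k)}_M=\widehat F_{11}+\widehat F_{22}-2\widehat F_{12}$. *Theorem.* For every $\delta_0<1$ there is a constant $C>0$, depending only on $\delta_0$, such that the following holds. Let $k\ge 1$, $n\ge 0$ be integers and let $\epsilon,\epsilon_b,\delta$ be reals with $\epsilon_b\ge 0$, $0<\delta\le\delta_0$, $$\epsilon>32k\sqrt{\epsilon_b}\qquad\text{and}\qquad n^2\ge\frac{k!}{(\epsilon-32k\sqrt{\epsilon_b})^2}\log\frac1\delta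 .$$ Then there is an integer $$0\le M_0\le C\left(\frac{k!}{(\epsilon-32k\sqrt{\epsilon_b})^2}\log\frac1\delta\right)^{1/k}n^{2-2/k}$$ such that for all $d$, all $N\ge 1$, all uniform pure $N$-state ensembles $E_1,E_2$ in $\mathbb{C}^d$, each divided uniformly into $n$ $\varepsilon$-balls of radius $\epsilon_b$, and all $M\ge M_0$, $$\Pr\left[\,\bigl|\widehat{\mathcal D}^{(k)}_M-\mathcal D^{(k)}(E_1,E_2)\bigr|>\epsilon\,\right]\le\delta .$$ -/

import Mathlib

open scoped ENNReal

namespace QuantumMMD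

/-- A pure state of a `d`-dimensional quantum system: a unit vector of `ℂ^d`. -/
def PureState (d : ℕ) : Type := {v : EuclideanSpace ℂ (Fin d) // ‖v‖ = 1}

/-- The fidelity `|⟨ψ|φ⟩|²`. -/
noncomputable def fidelity {d : ℕ} (ψ φ : PureState d) : ℝ := ‖inner ℂ ψ.1 φ.1‖ ^ 2

/-- A uniform pure ensemble: `N` pure states indexed by `Fin N`, each with probability `1 / N`. -/
abbrev Ensemble (d N : ℕ) : Type := Fin N → PureState d

/-- `F̄^(k)(E, E')`, the mean of `|⟨ψ|φ⟩|^(2k)` over independent `ψ ∼ E` and `φ ∼ E'`. -/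
noncomputable def meanFidelity {d N : ℕ} (k : ℕ) (E E' : Ensemble d N) : ℝ :=
  (∑ i, ∑ j, fidelity (E i) (E' j) ^ k) / (N : ℝ) ^ 2

/-- The MMD-`k` pseudo-distance. -/
noncomputable def mmd {d N : ℕ} (k : ℕ) (E₁ E₂ : Ensemble d N) : ℝ :=
  meanFidelity k E₁ E₁ + meanFidelity k E₂ E₂ - 2 * meanFidelity k E₁ E₂

/-! ### The SWAP test -/

/-- (Unnormalised) vectors of `ℂ² ⊗ ℂ^d ⊗ ℂ^d`, in coordinates; the first factor is the ancilla. -/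
abbrev Register (d : ℕ) : Type := Fin 2 → Fin d → Fin d → ℂ

/-- The Hadamard gate on the ancilla. -/
noncomputable def hadamard {d : ℕ} (v : Register d) : Register d :=
  fun b s t => (v 0 s t + (-1) ^ (b : ℕ) * v 1 s t) / (Real.sqrt 2 : ℂ)

/-- Exchange of the two systems, controlled by the ancilla. -/
def controlledSwap {d : ℕ} (v : Register d) : Register d :=
  fun b s t => if b = 0 then v b s t else v b t s

/-- The input `|0⟩ ⊗ |ψ⟩ ⊗ |φ⟩`. -/
def swapTestInput {d : ℕ} (ψ φ : PureState d) : Register d :=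
  fun b s t => if b = 0 then ψ.1 s * φ.1 t else 0

/-- The output state of the SWAP-test circuit, before the measurement. -/
noncomputable def swapTestOutput {d : ℕ} (ψ φ : PureState d) : Register d :=
  hadamard (controlledSwap (hadamard (swapTestInput ψ φ)))

/-- Born rule: the probability that measuring the ancilla gives `b`. -/
noncomputable def swapTestProb {d : ℕ} (ψ φ : PureState d) (b : Fin 2) : ℝ :=
  ∑ s, ∑ t, ‖swapTestOutput ψ φ b s t‖ ^ 2

theorem swapTestOutput_eq {d : ℕ} (ψ φ : PureState d) (b : Fin 2) (s t : Fin d) :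
    swapTestOutput ψ φ b s t
      = (ψ.1 s * φ.1 t + (-1) ^ (b : ℕ) * (ψ.1 t * φ.1 s)) / 2 := by
  have h : (Real.sqrt 2 : ℂ) * (Real.sqrt 2 : ℂ) = 2 := by
    rw [← Complex.ofReal_mul, Real.mul_self_sqrt (by norm_num)]; norm_num
  simp only [swapTestOutput, hadamard, controlledSwap, swapTestInput]
  simp only [if_true, one_ne_zero, if_false, mul_zero, add_zero]
  rw [← mul_div_assoc, ← add_div, div_div, h]

theorem sum_normSq {d : ℕ} (ψ : PureState d) : ∑ s, ‖ψ.1 s‖ ^ 2 = 1 := by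
  rw [← EuclideanSpace.norm_sq_eq, ψ.2]; norm_num

theorem swapTestProb_eq {d : ℕ} (ψ φ : PureState d) (b : Fin 2) :
    swapTestProb ψ φ b = (1 + (-1) ^ (b : ℕ) * fidelity ψ φ) / 2 := by
  have e : ∀ z : ℂ, ((‖z‖ ^ 2 : ℝ) : ℂ) = (starRingEnd ℂ) z * z := fun z => by
    rw [Complex.conj_mul']; push_cast; rfl
  have hψ : ∑ s, (starRingEnd ℂ) (ψ.1 s) * ψ.1 s = 1 := by
    simp only [← e]; rw [← Complex.ofReal_sum, sum_normSq]; simp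
  have hφ : ∑ s, (starRingEnd ℂ) (φ.1 s) * φ.1 s = 1 := by
    simp only [← e]; rw [← Complex.ofReal_sum, sum_normSq]; simp
  have hF : ((fidelity ψ φ : ℝ) : ℂ)
      = (∑ t, ψ.1 t * (starRingEnd ℂ) (φ.1 t)) * ∑ s, (starRingEnd ℂ) (ψ.1 s) * φ.1 s := by
    rw [fidelity, e]
    simp only [PiLp.inner_apply, RCLike.inner_apply, map_sum, map_mul, Complex.conj_conj]
    congr 1 <;> exact Finset.sum_congr rfl fun _ _ => mul_comm _ _
  have hF' : ((fidelity ψ φ : ℝ) : ℂ)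
      = (∑ s, (starRingEnd ℂ) (ψ.1 s) * φ.1 s) * ∑ t, ψ.1 t * (starRingEnd ℂ) (φ.1 t) := by
    rw [hF, mul_comm]
  have hb : ((-1 : ℂ) ^ (b : ℕ)) * (-1 : ℂ) ^ (b : ℕ) = 1 := by
    rw [← mul_pow]; norm_num
  apply Complex.ofReal_injective
  rw [swapTestProb]
  push_cast
  have key : ∀ s t : Fin d, ((‖swapTestOutput ψ φ b s t‖ : ℂ)) ^ 2 =
      ((starRingEnd ℂ) (ψ.1 s) * ψ.1 s * ((starRingEnd ℂ) (φ.1 t) * φ.1 t)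
        + (starRingEnd ℂ) (φ.1 s) * φ.1 s * ((starRingEnd ℂ) (ψ.1 t) * ψ.1 t)
        + (-1) ^ (b : ℕ) * (((starRingEnd ℂ) (ψ.1 s) * φ.1 s)
            * (ψ.1 t * (starRingEnd ℂ) (φ.1 t)))
        + (-1) ^ (b : ℕ) * ((ψ.1 s * (starRingEnd ℂ) (φ.1 s))
            * ((starRingEnd ℂ) (ψ.1 t) * φ.1 t))) / 4 := by
    intro s t
    have := e (swapTestOutput ψ φ b s t)
    push_cast at this
    rw [this, swapTestOutput_eq]
    simp only [map_div₀, map_add, map_mul, map_pow, map_neg, map_one, map_ofNat]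
    linear_combination ((starRingEnd ℂ) (ψ.1 t) * (starRingEnd ℂ) (φ.1 s) * ψ.1 t * φ.1 s / 4) * hb
  simp only [key, ← Finset.sum_div, Finset.sum_add_distrib, ← Finset.mul_sum, ← Finset.sum_mul]
  rw [hψ, hφ, ← hF', ← hF]
  ring

theorem swapTestProb_nonneg {d : ℕ} (ψ φ : PureState d) (b : Fin 2) : 0 ≤ swapTestProb ψ φ b :=
  Finset.sum_nonneg fun _ _ => Finset.sum_nonneg fun _ _ => by positivity

/-- The law of the ancilla measurement at the end of a SWAP test on `ψ` and `φ`. -/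
noncomputable def swapTest {d : ℕ} (ψ φ : PureState d) : PMF (Fin 2) :=
  PMF.ofFintype (fun b => ENNReal.ofReal (swapTestProb ψ φ b)) <| by
    rw [← ENNReal.ofReal_sum_of_nonneg fun b _ => swapTestProb_nonneg ψ φ b, Fin.sum_univ_two,
      swapTestProb_eq, swapTestProb_eq, ← ENNReal.ofReal_one]
    congr 1
    simp
    ring

/-! ### Ball groupings -/

/-- The `ε`-ball of radius `εb` around the central state `c`. -/
def epsBall {d : ℕ} (c : PureState d) (εb : ℝ) : Set (PureState d) :=
  {ψ | 1 - fidelity ψ c ≤ εb}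

/-- A division of the states of `E` uniformly into `n` `ε`-balls of radius `εb`: every state is
assigned to one of the balls, in which it lies, and every ball receives `N / n` states. -/
structure BallGrouping {d N : ℕ} (E : Ensemble d N) (n : ℕ) (εb : ℝ) where
  center : Fin n → PureState d
  ball : Fin N → Fin n
  mem_ball : ∀ i, E i ∈ epsBall (center (ball i)) εb
  uniform : ∀ a, n * (Finset.univ.filter fun i => ball i = a).card = N

/-! ### Sampling -/

/-- One sample: a label (a pair of balls) and the outcome of the ancilla measurement. -/
abbrev Sample (n : ℕ) : Type := (Fin n × Fin n) × Fin 2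

/-- The value `R = 1` for the outcome `0` and `R = -1` for the outcome `1`. -/
def Sample.R {n : ℕ} (x : Sample n) : ℝ := if x.2 = 0 then 1 else -1

/-- The law of one sample: indices `i`, `j` are drawn independently and uniformly, a SWAP test is
run on `E i` and `E' j`, and only the balls of the two states and the outcome are kept. -/
noncomputable def sampleLaw {d N n : ℕ} [NeZero N] (E E' : Ensemble d N)
    (g g' : Fin N → Fin n) : PMF (Sample n) :=
  (PMF.uniformOfFintype (Fin N × Fin N)).bind fun ij =>
    (swapTest (E ij.1) (E' ij.2)).map fun b => ((g ij.1, g' ij.2), b)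

/-- The law of `r` independent samples. -/
noncomputable def dataLaw {d N n : ℕ} [NeZero N] (r : ℕ) (E E' : Ensemble d N)
    (g g' : Fin N → Fin n) : MeasureTheory.Measure (Fin r → Sample n) :=
  MeasureTheory.Measure.pi fun _ => (sampleLaw E E' g g').toMeasure

/-! ### The U-statistic estimator -/

/-- The positions of the samples with label `l`; their number is `T_l`. -/
def positions {n r : ℕ} (x : Fin r → Sample n) (l : Fin n × Fin n) : Finset (Fin r) :=
  Finset.univ.filter fun t => (x t).1 = l

/-- The order-`k` U-statistic `Z_l` of the samples with label `l`. -/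
noncomputable def uStat {n r : ℕ} (k : ℕ) (x : Fin r → Sample n) (l : Fin n × Fin n) : ℝ :=
  (∑ S ∈ (positions x l).powersetCard k, ∏ t ∈ S, (x t).R) / ((positions x l).card.choose k : ℝ)

/-- The labels that occur at least `k` times; their number is `m`. -/
def goodLabels {n r : ℕ} (k : ℕ) (x : Fin r → Sample n) : Finset (Fin n × Fin n) :=
  Finset.univ.filter fun l => k ≤ (positions x l).card

/-- The estimator of `F̄^(k)`, the mean of `Z_l` over the labels that occur at least `k` times
(`0` if there is no such label). -/
noncomputable def meanFidelityEst {n r : ℕ} (k : ℕ) (x : Fin r → Sample n) : ℝ :=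
  (∑ l ∈ goodLabels k x, uStat k x l) / ((goodLabels k x).card : ℝ)

/-- The estimator of MMD-`k`, from the data of the pairs `(1,1)`, `(2,2)` and `(1,2)`. -/
noncomputable def mmdEst {n r : ℕ} (k : ℕ)
    (x : (Fin r → Sample n) × (Fin r → Sample n) × (Fin r → Sample n)) : ℝ :=
  meanFidelityEst k x.1 + meanFidelityEst k x.2.1 - 2 * meanFidelityEst k x.2.2

/-- The probability that the estimator, run with `M` samples in total, a third of them (rounded
down) for each of the three pairs of ensembles, misses MMD-`k` by more than `ε`. -/
noncomputable def failureProb {d N n : ℕ} [NeZero N] (k M : ℕ) (ε : ℝ) (E₁ E₂ : Ensemble d N)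
    (g₁ g₂ : Fin N → Fin n) : ℝ≥0∞ :=
  ((dataLaw (M / 3) E₁ E₁ g₁ g₁).prod
      ((dataLaw (M / 3) E₂ E₂ g₂ g₂).prod (dataLaw (M / 3) E₁ E₂ g₁ g₂)))
    {x | ε < |mmdEst k x - mmd k E₁ E₂|}

end QuantumMMD

open QuantumMMD

namespace QuantumMMD

/-! ### Expectations under finite product weights -/

/-! Because all balls have equal size, a sample's label is uniform on `v = n²` values. Given its
label `l`, its sign has mean `μ l`, the average fidelity over the pairs labelled `l`
(`toReal_sampleLaw`). Pairs with one label have fidelities within a multiple of `√εb` of each other,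
so the mean of `μ l ^ k` differs from the target by at most `8k√εb` (`abs_meanFidelity_sub_le`).
With weights 1, 1, 2 this bias uses up `32k√εb`. It then suffices that each of the three estimators
deviates by at most `η / 4`, where `η = ε - 32k√εb`.

Let `J l` indicate that `l` occurs at least `k` times, with probability `q`. The estimator is `(∑ J
Z) / ∑ J`, so three sums have to concentrate: `∑ J (Z - μ^k)`, `∑ (J - q) μ^k` and `∑ (J - q)`
(`abs_ratio_sub_mean_le`). Given the labels, the `Z l` use disjoint sets of independent signs and
have variance at most `min 1 (k² / T l)` (`pexp_exp_signStat_le`). The counts are dependent, but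
negatively so: a letter can help at most one label. Hence exponential moments of same-sign
combinations of the `J l` are bounded by those of independent indicators (`pexp_mul_le`,
`pexp_exp_sum_often_le`), and Chernoff bounds apply (`pexp_labelEst_le`).

Write the sample size as a constant times `y v`, where `y^k v η² = k! log (1/δ)`; the hypothesis on
`n` says `y ≤ 1`. For small `y` or large `k`, `q` exceeds a large multiple of `y^k / k!`, so `q v
η²` dominates `log (1/δ)` (`pexp_labelEst_le_of_many`). Otherwise `k` is bounded and `y` is bounded
below. The number of usable labels may then be saturated at `v`, and further samples help by making
almost every count large, which reduces the variances (`pexp_labelEst_le_of_threshold`).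
`exists_sample_constant` joins the two regimes. -/

/-- The expectation of `f` under the product of the weights `w t`. -/
noncomputable def pexp {ι α : Type*} [Fintype ι] [DecidableEq ι] [Fintype α] (w : ι → α → ℝ)
    (f : (ι → α) → ℝ) : ℝ :=
  ∑ x, (∏ t, w t (x t)) * f x

section pexp

variable {ι α : Type*} [Fintype ι] [DecidableEq ι] [Fintype α] {w : ι → α → ℝ}

theorem pexp_prod (w h : ι → α → ℝ) :
    pexp w (fun x => ∏ t, h t (x t)) = ∏ t, ∑ a, w t a * h t a := by
  rw [Finset.prod_univ_sum, Fintype.piFinset_univ, pexp]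
  exact Finset.sum_congr rfl fun x _ => Finset.prod_mul_distrib.symm

theorem pexp_const (hw : ∀ t, ∑ a, w t a = 1) (c : ℝ) : pexp w (fun _ => c) = c := by
  have h := pexp_prod w (fun _ _ => (1 : ℝ))
  simp only [Finset.prod_const_one, mul_one, hw, pexp] at h
  rw [pexp, ← Finset.sum_mul, h, one_mul]

theorem pexp_mono (hw : ∀ t a, 0 ≤ w t a) {f g : (ι → α) → ℝ} (h : ∀ x, f x ≤ g x) :
    pexp w f ≤ pexp w g :=
  Finset.sum_le_sum fun x _ =>
    mul_le_mul_of_nonneg_left (h x) (Finset.prod_nonneg fun t _ => hw t _)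

theorem pexp_nonneg (hw : ∀ t a, 0 ≤ w t a) {f : (ι → α) → ℝ} (h : ∀ x, 0 ≤ f x) :
    0 ≤ pexp w f :=
  Finset.sum_nonneg fun x _ => mul_nonneg (Finset.prod_nonneg fun t _ => hw t _) (h x)

theorem pexp_add (f g : (ι → α) → ℝ) :
    pexp w (fun x => f x + g x) = pexp w f + pexp w g := by
  simp only [pexp, mul_add, Finset.sum_add_distrib]

theorem pexp_const_mul (c : ℝ) (f : (ι → α) → ℝ) :
    pexp w (fun x => c * f x) = c * pexp w f := by
  simp only [pexp, Finset.mul_sum]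
  exact Finset.sum_congr rfl fun x _ => by ring

theorem pexp_sum {κ : Type*} (s : Finset κ) (f : κ → (ι → α) → ℝ) :
    pexp w (fun x => ∑ j ∈ s, f j x) = ∑ j ∈ s, pexp w (f j) := by
  simp only [pexp, Finset.mul_sum]
  exact Finset.sum_comm

/-- Markov's inequality for the exponential moment. -/
theorem pexp_indicator_le (hw : ∀ t a, 0 ≤ w t a) (f : (ι → α) → ℝ) {θ : ℝ} (hθ : 0 ≤ θ)
    (s : ℝ) :
    pexp w (fun x => if s < f x then 1 else 0)
      ≤ Real.exp (-(θ * s)) * pexp w (fun x => Real.exp (θ * f x)) := by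
  rw [← pexp_const_mul]
  refine pexp_mono hw fun x => ?_
  rw [← Real.exp_add]
  split_ifs with h
  · exact Real.one_le_exp (by nlinarith)
  · positivity

end pexp

theorem pexp_succ {α : Type*} [Fintype α] {r : ℕ} (w : Fin (r + 1) → α → ℝ)
    (f : (Fin (r + 1) → α) → ℝ) :
    pexp w f = ∑ a, w 0 a * pexp (fun t => w t.succ) (fun x => f (Fin.cons a x)) := by
  have e := Fintype.sum_equiv (Fin.consEquiv (fun _ : Fin (r + 1) => α))
    (fun p => w 0 p.1 * ((∏ t : Fin r, w t.succ (p.2 t)) * f (Fin.cons p.1 p.2)))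
    (fun x => (∏ t, w t (x t)) * f x)
    (fun p => by simp [Fin.consEquiv, Fin.prod_univ_succ, mul_assoc])
  rw [pexp, ← e, Fintype.sum_prod_type]
  exact Finset.sum_congr rfl fun a _ => by rw [pexp, Finset.mul_sum]

/-- This is conditioning: all labels can be drawn first, and then the signs, independently given the
labels. -/
theorem pexp_prodMk {ι α β : Type*} [Fintype ι] [DecidableEq ι] [Fintype α] [Fintype β]
    (u : ι → α → ℝ) (ρ : α → β → ℝ) (f : (ι → α × β) → ℝ) :
    pexp (fun t x => u t x.1 * ρ x.1 x.2) f
      = pexp u (fun y => pexp (fun t => ρ (y t)) (fun b => f fun t => (y t, b t))) := by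
  have e := Fintype.sum_equiv (Equiv.arrowProdEquivProdArrow ι (fun _ => α) (fun _ => β)).symm
    (fun p => (∏ t, u t (p.1 t)) * ((∏ t, ρ (p.1 t) (p.2 t)) * f fun t => (p.1 t, p.2 t)))
    (fun x => (∏ t, u t (x t).1 * ρ (x t).1 (x t).2) * f x)
    (fun p => by simp [Equiv.arrowProdEquivProdArrow, Finset.prod_mul_distrib, mul_assoc])
  rw [pexp, ← e, Fintype.sum_prod_type]
  exact Finset.sum_congr rfl fun a _ => by simp only [pexp, Finset.mul_sum]

/-! ### Negative association -/

/-- `c * f` does not decrease when letters outside `A` are replaced. -/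
def MonoOff {ι α : Type*} (c : ℝ) (A : ι → α → Prop) (f : (ι → α) → ℝ) : Prop :=
  ∀ x x' : ι → α, (∀ t, x t ≠ x' t → ¬ A t (x t)) → c * f x ≤ c * f x'

/-- Chebyshev's association inequality: average the hypothesis over two independent copies of the
letter. -/
theorem sum_mul_le_of_opposite {α : Type*} [Fintype α] (w φ γ : α → ℝ) (hw : ∀ a, 0 ≤ w a)
    (h1 : ∑ a, w a = 1) (h : ∀ a b, (φ a - φ b) * (γ a - γ b) ≤ 0) :
    ∑ a, w a * (φ a * γ a) ≤ (∑ a, w a * φ a) * ∑ a, w a * γ a := by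
  have key : ∑ a, ∑ b, w a * w b * ((φ a - φ b) * (γ a - γ b)) ≤ 0 :=
    Finset.sum_nonpos fun a _ => Finset.sum_nonpos fun b _ =>
      mul_nonpos_of_nonneg_of_nonpos (mul_nonneg (hw a) (hw b)) (h a b)
  have e : ∑ a, ∑ b, w a * w b * ((φ a - φ b) * (γ a - γ b))
      = (∑ a, w a * (φ a * γ a)) * ∑ b, w b + (∑ a, w a) * ∑ b, w b * (φ b * γ b)
        - (∑ a, w a * φ a) * (∑ b, w b * γ b) - (∑ a, w a * γ a) * ∑ b, w b * φ b := by
    simp only [Finset.sum_mul_sum, ← Finset.sum_add_distrib, ← Finset.sum_sub_distrib]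
    exact Finset.sum_congr rfl fun a _ => Finset.sum_congr rfl fun b _ => by ring
  rw [e, h1] at key
  linarith [mul_comm (∑ a, w a * φ a) (∑ a, w a * γ a)]

/-- Induct on the number of letters and condition on the first. As functions of that letter, the
conditional means of `c * f` and `c * g` attain their minimum at every letter outside `A` and `B`
respectively. No letter lies in both sets, so the two conditional means are oppositely ordered and
Chebyshev's inequality applies. -/
theorem pexp_mul_le {α : Type*} [Fintype α] {c : ℝ} (hc : c * c = 1) :
    ∀ {r : ℕ} (w : Fin r → α → ℝ), (∀ t a, 0 ≤ w t a) → (∀ t, ∑ a, w t a = 1) →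
    ∀ (A B : Fin r → α → Prop), (∀ t a, A t a → ¬ B t a) →
    ∀ f g : (Fin r → α) → ℝ, MonoOff c A f → MonoOff c B g →
      pexp w (fun x => f x * g x) ≤ pexp w f * pexp w g := by
  intro r
  induction r with
  | zero =>
    intro w _ _ A B _ f g _ _
    simp [pexp]
  | succ r ih =>
    intro w hw h1 A B hAB f g hf hg
    simp only [pexp_succ w]
    have cons_off : ∀ (C : Fin (r + 1) → α → Prop) (h : (Fin (r + 1) → α) → ℝ),
        MonoOff c C h → ∀ a, MonoOff c (fun t => C t.succ) (fun x => h (Fin.cons a x)) := by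
      intro C h hh a x x' hx
      refine hh _ _ fun t => ?_
      refine Fin.cases (by simp) (fun t => ?_) t
      simpa using hx t
    have head_off : ∀ (C : Fin (r + 1) → α → Prop) (h : (Fin (r + 1) → α) → ℝ),
        MonoOff c C h → ∀ a b, ¬ C 0 a →
          c * pexp (fun t => w t.succ) (fun x => h (Fin.cons a x))
            ≤ c * pexp (fun t => w t.succ) (fun x => h (Fin.cons b x)) := by
      intro C h hh a b ha
      rw [← pexp_const_mul, ← pexp_const_mul]
      refine pexp_mono (fun t => hw (Fin.succ t)) fun x => hh _ _ fun t => ?_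
      refine Fin.cases (by simpa using fun _ => ha) (fun t => ?_) t
      simp
    refine le_trans (Finset.sum_le_sum fun a _ => mul_le_mul_of_nonneg_left
      (ih _ (fun t => hw (Fin.succ t)) (fun t => h1 (Fin.succ t)) _ _
        (fun t => hAB (Fin.succ t)) _ _
        (cons_off A f hf a) (cons_off B g hg a)) (hw 0 a)) ?_
    refine sum_mul_le_of_opposite _ _ _ (hw 0) (h1 0) fun a b => ?_
    set φ : α → ℝ := fun a => pexp (fun t => w (Fin.succ t)) (fun x => f (Fin.cons a x))
    set γ : α → ℝ := fun a => pexp (fun t => w (Fin.succ t)) (fun x => g (Fin.cons a x))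
    have hfa : ∀ a b, ¬ A 0 a → c * φ a ≤ c * φ b := head_off A f hf
    have hgb : ∀ a b, ¬ B 0 a → c * γ a ≤ c * γ b := head_off B g hg
    have e : (φ a - φ b) * (γ a - γ b)
        = (c * φ a - c * φ b) * (c * γ a - c * γ b) := by
      linear_combination (-(φ a - φ b) * (γ a - γ b)) * hc
    change (φ a - φ b) * (γ a - γ b) ≤ 0
    rw [e]
    by_cases ha : A 0 a <;> by_cases hb : A 0 b
    · have h1 := hgb a b (hAB 0 a ha)
      have h2 := hgb b a (hAB 0 b hb)
      rw [le_antisymm h1 h2]; simp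
    · have h1 := hgb a b (hAB 0 a ha)
      have h2 := hfa b a hb
      exact mul_nonpos_of_nonneg_of_nonpos (sub_nonneg.2 h2) (sub_nonpos.2 h1)
    · have h1 := hgb b a (hAB 0 b hb)
      have h2 := hfa a b ha
      exact mul_nonpos_of_nonpos_of_nonneg (sub_nonpos.2 h2) (sub_nonneg.2 h1)
    · have h1 := hfa a b ha
      have h2 := hfa b a hb
      rw [le_antisymm h1 h2]; simp

/-- Expectations of products of nonnegative functions that are monotone off disjoint sets of
letters are at most the products of the expectations. -/
theorem pexp_prod_le {α Λ : Type*} [Fintype α] [DecidableEq Λ] {c : ℝ} (hc : c = 1 ∨ c = -1)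
    {r : ℕ} (w : Fin r → α → ℝ) (hw : ∀ t a, 0 ≤ w t a) (h1 : ∀ t, ∑ a, w t a = 1)
    (A : Λ → Fin r → α → Prop) (hA : ∀ l l' t a, A l t a → A l' t a → l = l')
    (f : Λ → (Fin r → α) → ℝ) (hf : ∀ l, MonoOff c (A l) (f l)) (hf0 : ∀ l x, 0 ≤ f l x)
    (s : Finset Λ) :
    pexp w (fun x => ∏ l ∈ s, f l x) ≤ ∏ l ∈ s, pexp w (f l) := by
  induction s using Finset.induction_on with
  | empty => simp [pexp_const h1]
  | insert l s hl ih =>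
    simp only [Finset.prod_insert hl]
    refine le_trans (pexp_mul_le (c := c) (by rcases hc with rfl | rfl <;> norm_num) w hw h1
      (A l) (fun t a => ∃ l' ∈ s, A l' t a) ?_ _ _ (hf l) ?_) ?_
    · rintro t a h ⟨l', hl', h'⟩
      exact hl (hA _ _ _ _ h h' ▸ hl')
    · intro x x' hx
      have hx' : ∀ l ∈ s, c * f l x ≤ c * f l x' := fun l hl =>
        hf l x x' fun t ht ha => hx t ht ⟨l, hl, ha⟩
      rcases hc with rfl | rfl
      · simp only [one_mul] at hx' ⊢
        exact Finset.prod_le_prod (fun l _ => hf0 l x) hx'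
      · simp only [neg_mul, one_mul, neg_le_neg_iff] at hx' ⊢
        exact Finset.prod_le_prod (fun l _ => hf0 l x') hx'
    · exact mul_le_mul_of_nonneg_left ih (pexp_nonneg hw (hf0 l))

/-! ### Tails of the binomial distribution -/

/-- The probability of at least `k` successes in `r` trials with success probability `p`. -/
def binTail (p : ℝ) : ℕ → ℕ → ℝ
  | _, 0 => 1
  | 0, _ + 1 => 0
  | r + 1, k + 1 => p * binTail p r k + (1 - p) * binTail p r (k + 1)

section binTail

variable {p : ℝ}

@[simp] theorem binTail_zero_right (p : ℝ) (r : ℕ) : binTail p r 0 = 1 := by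
  cases r <;> rfl

theorem binTail_nonneg (h0 : 0 ≤ p) (h1 : p ≤ 1) (r k : ℕ) : 0 ≤ binTail p r k := by
  induction r generalizing k with
  | zero => cases k <;> simp [binTail]
  | succ r ih =>
    cases k with
    | zero => simp
    | succ k =>
      exact add_nonneg (mul_nonneg h0 (ih k)) (mul_nonneg (by linarith) (ih (k + 1)))

theorem binTail_le_one (h0 : 0 ≤ p) (h1 : p ≤ 1) (r k : ℕ) : binTail p r k ≤ 1 := by
  induction r generalizing k with
  | zero => cases k <;> simp [binTail]
  | succ r ih =>
    cases k with
    | zero => simp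
    | succ k =>
      rw [binTail]
      nlinarith [ih k, ih (k + 1)]

theorem binTail_succ_le (h0 : 0 ≤ p) (h1 : p ≤ 1) (r k : ℕ) :
    binTail p r (k + 1) ≤ binTail p r k := by
  induction r generalizing k with
  | zero => cases k <;> simp [binTail]
  | succ r ih =>
    cases k with
    | zero => simpa using binTail_le_one h0 h1 (r + 1) 1
    | succ k =>
      rw [binTail, binTail]
      exact add_le_add (mul_le_mul_of_nonneg_left (ih k) h0)
        (mul_le_mul_of_nonneg_left (ih (k + 1)) (by linarith))

theorem binTail_antitone (h0 : 0 ≤ p) (h1 : p ≤ 1) (r : ℕ) : Antitone (binTail p r) :=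
  antitone_nat_of_succ_le (binTail_succ_le h0 h1 r)

theorem binTail_mono (h0 : 0 ≤ p) (h1 : p ≤ 1) (k : ℕ) : Monotone fun r => binTail p r k := by
  refine monotone_nat_of_le_succ fun r => ?_
  cases k with
  | zero => simp
  | succ k =>
    simp only [binTail]
    nlinarith [binTail_succ_le h0 h1 r k]

/-- The tail grows with the success probability, so `p` may be lowered to `s`. This freedom keeps
the factor `1 - s` away from zero even when `p = 1`. -/
theorem le_binTail {s : ℝ} (hs : 0 ≤ s) (hsp : s ≤ p) (h1 : p ≤ 1) (r k : ℕ) :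
    (r.choose k : ℝ) * s ^ k * (1 - s) ^ r ≤ binTail p r k := by
  induction r generalizing k with
  | zero => cases k <;> simp [binTail]
  | succ r ih =>
    cases k with
    | zero => simpa using pow_le_one₀ (by linarith) (by linarith)
    | succ k =>
      have hd := binTail_succ_le (hs.trans hsp) h1 r k
      have h1s : 0 ≤ 1 - s := by linarith
      have step : s * binTail p r k + (1 - s) * binTail p r (k + 1) ≤ binTail p (r + 1) (k + 1) := by
        rw [binTail]; nlinarith
      refine le_trans ?_ step
      have a := mul_le_mul_of_nonneg_left (ih k) hs
      have b := mul_le_mul_of_nonneg_left (ih (k + 1)) h1s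
      have c : 0 ≤ s * ((r.choose k : ℝ) * s ^ k * (1 - s) ^ r) * s := by positivity
      rw [Nat.choose_succ_succ]
      push_cast
      rw [pow_succ s k, pow_succ (1 - s) r] at *
      nlinarith

/-- The Chernoff bound from the moment of `exp (-X)` for binomial `X`, proved along the recursion
for the tail. -/
theorem one_sub_binTail_le (h0 : 0 ≤ p) (h1 : p ≤ 1) (r k : ℕ) :
    1 - binTail p r k ≤ Real.exp k * (1 - p * (1 - Real.exp (-1))) ^ r := by
  have he : Real.exp (-1) ≤ 1 := by simp
  have hp : 0 ≤ 1 - p * (1 - Real.exp (-1)) := by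
    nlinarith [Real.exp_pos (-1)]
  induction r generalizing k with
  | zero =>
    cases k with
    | zero => simp
    | succ k =>
      simp only [binTail, pow_zero, mul_one, sub_zero]
      exact Real.one_le_exp (by positivity)
  | succ r ih =>
    cases k with
    | zero => simpa using pow_nonneg hp (r + 1)
    | succ k =>
      rw [binTail]
      have a := mul_le_mul_of_nonneg_left (ih k) h0
      have b := mul_le_mul_of_nonneg_left (ih (k + 1)) (sub_nonneg.2 h1)
      have e : Real.exp (k : ℝ) = Real.exp ((k + 1 : ℕ) : ℝ) * Real.exp (-1) := by
        rw [← Real.exp_add]; congr 1; push_cast; ring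
      rw [e] at a
      rw [pow_succ]
      nlinarith

theorem one_sub_binTail_le_exp (h0 : 0 ≤ p) (h1 : p ≤ 1) (r k : ℕ) :
    1 - binTail p r k ≤ Real.exp (k - p * r / 2) := by
  refine (one_sub_binTail_le h0 h1 r k).trans ?_
  have he : Real.exp (-1) ≤ 1 / 2 := by
    have := Real.add_one_le_exp (1 : ℝ)
    rw [Real.exp_neg, inv_eq_one_div]
    exact one_div_le_one_div_of_le (by norm_num) (by linarith)
  have hp : 0 ≤ 1 - p * (1 - Real.exp (-1)) := by
    nlinarith [Real.exp_pos (-1)]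
  have h2 : 1 - p * (1 - Real.exp (-1)) ≤ Real.exp (-(p / 2)) := by
    nlinarith [Real.add_one_le_exp (-(p / 2))]
  calc _ ≤ Real.exp k * Real.exp (-(p / 2)) ^ r := by gcongr
    _ = _ := by rw [← Real.exp_nat_mul, ← Real.exp_add]; congr 1; ring

end binTail

/-! ### Label counts -/

/-- The number of occurrences of `l` in `y`. -/
def count {Λ : Type*} [DecidableEq Λ] {r : ℕ} (y : Fin r → Λ) (l : Λ) : ℕ :=
  (Finset.univ.filter fun t => y t = l).card

/-- The indicator of the event that `l` occurs at least `k` times. -/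
def often {Λ : Type*} [DecidableEq Λ] {r : ℕ} (k : ℕ) (y : Fin r → Λ) (l : Λ) : ℝ :=
  if k ≤ count y l then 1 else 0

theorem count_cons {Λ : Type*} [DecidableEq Λ] {r : ℕ} (a : Λ) (x : Fin r → Λ) (l : Λ) :
    count (Fin.cons a x : Fin (r + 1) → Λ) l = (if a = l then 1 else 0) + count x l := by
  simp only [count, Finset.card_filter, Fin.sum_univ_succ, Fin.cons_zero, Fin.cons_succ]

theorem exp_le_quadratic (y : ℝ) : Real.exp y ≤ 1 + y + y ^ 2 * Real.exp |y| := by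
  have h := Complex.norm_exp_sub_sum_le_norm_mul_exp (y : ℂ) 2
  have e : Complex.exp (y : ℂ) - ∑ m ∈ Finset.range 2, (y : ℂ) ^ m / (m.factorial : ℂ)
      = ((Real.exp y - (1 + y) : ℝ) : ℂ) := by
    simp [Finset.sum_range_succ]
  rw [e, Complex.norm_real, Complex.norm_real, Real.norm_eq_abs, Real.norm_eq_abs, sq_abs] at h
  linarith [le_abs_self (Real.exp y - (1 + y))]

section labels

variable {Λ : Type*} [Fintype Λ] [DecidableEq Λ] {u : Λ → ℝ}

theorem pexp_often (hu1 : ∑ l, u l = 1) (l : Λ) (r k : ℕ) :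
    pexp (fun _ : Fin r => u) (fun y => often k y l) = binTail (u l) r k := by
  induction r generalizing k with
  | zero => cases k <;> simp [binTail, pexp, often, count]
  | succ r ih =>
    cases k with
    | zero => simpa [often] using pexp_const (w := fun _ : Fin (r + 1) => u) (fun _ => hu1) 1
    | succ k =>
      rw [pexp_succ, binTail, ← ih k, ← ih (k + 1)]
      have e : ∀ a, pexp (fun _ : Fin r => u) (fun x => often (k + 1) (Fin.cons a x : Fin (r + 1) → Λ) l)
          = if a = l then pexp (fun _ : Fin r => u) (fun y => often k y l)
            else pexp (fun _ : Fin r => u) (fun y => often (k + 1) y l) := by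
        intro a
        split_ifs with h <;> congr 1 <;> funext x <;> simp only [often, count_cons, h, if_true,
          if_false, add_le_add_iff_right, zero_add, add_comm 1]
      simp only [e, mul_ite, ← Finset.sum_add_sum_compl {l}]
      rw [Finset.sum_singleton, if_pos rfl]
      have e2 : ∑ a ∈ ({l} : Finset Λ)ᶜ, (if a = l then u a * pexp (fun _ : Fin r => u) (fun y => often k y l)
            else u a * pexp (fun _ : Fin r => u) (fun y => often (k + 1) y l))
          = (∑ a ∈ ({l} : Finset Λ)ᶜ, u a) * pexp (fun _ : Fin r => u) (fun y => often (k + 1) y l) := by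
        rw [Finset.sum_mul]
        refine Finset.sum_congr rfl fun a ha => if_neg (by simpa using ha)
      rw [e2]
      have e3 : ∑ a ∈ ({l} : Finset Λ)ᶜ, u a = 1 - u l := by
        have := Finset.sum_add_sum_compl ({l} : Finset Λ) u
        rw [hu1, Finset.sum_singleton] at this
        linarith
      rw [e3]

theorem count_le_of_off {Λ : Type*} [DecidableEq Λ] {r : ℕ} (l : Λ) (x x' : Fin r → Λ)
    (h : ∀ t, x t ≠ x' t → ¬ x t = l) : count x l ≤ count x' l := by
  refine Finset.card_le_card fun t ht => ?_
  simp only [Finset.mem_filter, Finset.mem_univ, true_and] at ht ⊢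
  by_contra hne
  exact h t (fun e => hne (e ▸ ht)) ht

/-- The exponential moments of sums of label indicators are at most those of independent ones. -/
theorem pexp_exp_sum_often_le (hu : ∀ l, 0 ≤ u l) (hu1 : ∑ l, u l = 1) (r k : ℕ) (a : Λ → ℝ)
    (ha : (∀ l, 0 ≤ a l) ∨ ∀ l, a l ≤ 0) :
    pexp (fun _ : Fin r => u) (fun y => Real.exp (∑ l, a l * often k y l))
      ≤ ∏ l, (1 + binTail (u l) r k * (Real.exp (a l) - 1)) := by
  have e1 : ∀ l, pexp (fun _ : Fin r => u) (fun y => Real.exp (a l * often k y l))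
      = 1 + binTail (u l) r k * (Real.exp (a l) - 1) := by
    intro l
    have : ∀ y : Fin r → Λ, Real.exp (a l * often k y l)
        = 1 + (Real.exp (a l) - 1) * often k y l := by
      intro y; unfold often; split_ifs <;> simp
    simp only [this]
    rw [pexp_add, pexp_const (fun _ => hu1), pexp_const_mul, pexp_often hu1, mul_comm]
  have hmono : ∀ (l : Λ) (x x' : Fin r → Λ), (∀ t, x t ≠ x' t → ¬ x t = l) →
      often k x l ≤ often k x' l := by
    intro l x x' h
    have := count_le_of_off l x x' h
    unfold often
    split_ifs with h1 h2
    · rfl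
    · omega
    · norm_num
    · rfl
  -- The sign `c` handles increasing and decreasing functions of the counts together: `c * exp (a l
  -- * often k y l)` can only grow when letters other than `l` are replaced.
  have main : ∀ c : ℝ, (c = 1 ∨ c = -1) → (∀ l, 0 ≤ c * a l) →
      pexp (fun _ : Fin r => u) (fun y => ∏ l, Real.exp (a l * often k y l))
      ≤ ∏ l, pexp (fun _ : Fin r => u) (fun y => Real.exp (a l * often k y l)) := by
    intro c hc hca
    refine pexp_prod_le hc (fun _ : Fin r => u) (fun _ => hu) (fun _ => hu1)
      (fun l _ a => a = l) (fun l l' t a h h' => h ▸ h') _ (fun l x x' h => ?_)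
      (fun l x => (Real.exp_pos _).le) Finset.univ
    have hm := hmono l x x' h
    rcases hc with rfl | rfl
    · simp only [one_mul] at hca ⊢
      exact Real.exp_le_exp.2 (mul_le_mul_of_nonneg_left hm (hca l))
    · have := hca l
      simp only [neg_mul, one_mul, neg_le_neg_iff] at this ⊢
      exact Real.exp_le_exp.2 (mul_le_mul_of_nonpos_left hm (by linarith))
  simp only [Real.exp_sum, ← e1]
  rcases ha with ha | ha
  · exact main 1 (Or.inl rfl) (by simpa using ha)
  · exact main (-1) (Or.inr rfl) (by simpa using ha)

/-- Apply `exp_le_quadratic` at both values of the centred variable: the linear terms cancel and the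
squares average to the variance. The factor `1 - q` is what the regime of `q` near 1 relies on. -/
theorem bernoulli_mgf_le {q : ℝ} (h0 : 0 ≤ q) (h1 : q ≤ 1) (a : ℝ) :
    (1 + q * (Real.exp a - 1)) * Real.exp (-(q * a))
      ≤ Real.exp (q * (1 - q) * a ^ 2 * Real.exp |a|) := by
  have e : (1 + q * (Real.exp a - 1)) * Real.exp (-(q * a))
      = (1 - q) * Real.exp (-(q * a)) + q * Real.exp ((1 - q) * a) := by
    have : Real.exp ((1 - q) * a) = Real.exp a * Real.exp (-(q * a)) := by
      rw [← Real.exp_add]; congr 1; ring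
    rw [this]; ring
  have b : ∀ c : ℝ, |c| ≤ 1 → Real.exp (c * a) ≤ 1 + c * a + (c * a) ^ 2 * Real.exp |a| := by
    intro c hc
    refine (exp_le_quadratic _).trans ?_
    have : |c * a| ≤ |a| := by
      rw [abs_mul]; exact mul_le_of_le_one_left (abs_nonneg _) hc
    gcongr
  have b1 := b (-q) (by rw [abs_neg, abs_of_nonneg h0]; exact h1)
  have b2 := b (1 - q) (by rw [abs_of_nonneg (by linarith)]; linarith)
  rw [neg_mul] at b1
  have h1' : 0 ≤ 1 - q := by linarith
  rw [e]
  calc _ ≤ (1 - q) * (1 + -(q * a) + (-(q * a)) ^ 2 * Real.exp |a|)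
        + q * (1 + (1 - q) * a + ((1 - q) * a) ^ 2 * Real.exp |a|) := by gcongr
    _ = q * (1 - q) * a ^ 2 * Real.exp |a| + 1 := by ring
    _ ≤ _ := Real.add_one_le_exp _

theorem pexp_exp_centered_often_le (hu : ∀ l, 0 ≤ u l) (hu1 : ∑ l, u l = 1) {r k : ℕ} {q : ℝ}
    (hq : ∀ l, binTail (u l) r k = q) (h0 : 0 ≤ q) (h1 : q ≤ 1) (a : Λ → ℝ)
    (ha0 : ∀ l, 0 ≤ a l) (ha1 : ∀ l, a l ≤ 1) (θ : ℝ) :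
    pexp (fun _ : Fin r => u) (fun y => Real.exp (θ * ∑ l, (often k y l - q) * a l))
      ≤ Real.exp (Fintype.card Λ * (q * (1 - q) * θ ^ 2 * Real.exp |θ|)) := by
  have e : ∀ y : Fin r → Λ, Real.exp (θ * ∑ l, (often k y l - q) * a l)
      = Real.exp (-(∑ l, q * (θ * a l))) * Real.exp (∑ l, θ * a l * often k y l) := by
    intro y
    rw [← Real.exp_add]
    congr 1
    rw [Finset.mul_sum, ← Finset.sum_neg_distrib, ← Finset.sum_add_distrib]
    exact Finset.sum_congr rfl fun l _ => by ring
  simp only [e]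
  rw [pexp_const_mul]
  have hs : (∀ l, 0 ≤ θ * a l) ∨ ∀ l, θ * a l ≤ 0 := by
    rcases le_total 0 θ with h | h
    · exact Or.inl fun l => mul_nonneg h (ha0 l)
    · exact Or.inr fun l => mul_nonpos_of_nonpos_of_nonneg h (ha0 l)
  refine (mul_le_mul_of_nonneg_left (pexp_exp_sum_often_le hu hu1 r k _ hs)
    (Real.exp_pos _).le).trans ?_
  simp only [hq]
  rw [← Finset.sum_neg_distrib, Real.exp_sum, ← Finset.prod_mul_distrib, mul_comm (_ : ℝ) (q * _ * _ * _),
    mul_comm (_ * _) (Fintype.card Λ : ℝ), Real.exp_nat_mul, Fintype.card, ← Finset.prod_const]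
  refine Finset.prod_le_prod (fun l _ => mul_nonneg (Real.exp_pos _).le ?_) fun l _ => ?_
  · nlinarith [Real.exp_pos (θ * a l)]
  · rw [mul_comm]
    refine (bernoulli_mgf_le h0 h1 _).trans (Real.exp_le_exp.2 ?_)
    have hab : |θ * a l| ≤ |θ| := by
      rw [abs_mul, abs_of_nonneg (ha0 l)]
      exact mul_le_of_le_one_right (abs_nonneg _) (ha1 l)
    have hsq : (θ * a l) ^ 2 ≤ θ ^ 2 := sq_le_sq.2 hab
    have : 0 ≤ q * (1 - q) := mul_nonneg h0 (by linarith)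
    gcongr

end labels

/-! ### The U-statistic of independent signs -/

/-- The value `1` for the outcome `0` and `-1` for the outcome `1`. -/
def outcomeSign (b : Fin 2) : ℝ := if b = 0 then 1 else -1

theorem abs_prod_outcomeSign {ι : Type*} (b : ι → Fin 2) (A : Finset ι) :
    |∏ t ∈ A, outcomeSign (b t)| = 1 := by
  rw [Finset.abs_prod]
  exact Finset.prod_eq_one fun t _ => by unfold outcomeSign; split_ifs <;> norm_num

/-- The order-`k` U-statistic of the signs at the positions in `S`. -/
noncomputable def signStat {ι : Type*} (k : ℕ) (S : Finset ι) (b : ι → Fin 2) : ℝ :=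
  (∑ A ∈ S.powersetCard k, ∏ t ∈ A, outcomeSign (b t)) / (S.card.choose k : ℝ)

theorem abs_signStat_le {ι : Type*} (k : ℕ) (S : Finset ι) (b : ι → Fin 2) :
    |signStat k S b| ≤ 1 := by
  rw [signStat, abs_div, Nat.abs_cast]
  refine div_le_one_of_le₀ ((Finset.abs_sum_le_sum_abs _ _).trans ?_) (Nat.cast_nonneg _)
  simp [abs_prod_outcomeSign]

/-- The `k`-subsets through `t` correspond to the `(k - 1)`-subsets of the remaining points. -/
theorem card_filter_mem_powersetCard {ι : Type*} [DecidableEq ι] {S : Finset ι} {t : ι}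
    (ht : t ∈ S) (k : ℕ) :
    S.card * ((S.powersetCard k).filter fun A => t ∈ A).card = k * S.card.choose k := by
  obtain ⟨S', hS', rfl⟩ : ∃ S', t ∉ S' ∧ insert t S' = S :=
    ⟨S.erase t, by simp, Finset.insert_erase ht⟩
  cases k with
  | zero => simp
  | succ k =>
    have e : (((insert t S').powersetCard (k + 1)).filter fun A => t ∈ A)
        = (S'.powersetCard k).image (insert t) := by
      rw [Finset.powersetCard_succ_insert hS', Finset.filter_union,
        Finset.filter_eq_empty_iff.2, Finset.empty_union, Finset.filter_eq_self.2]
      · intro A hA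
        obtain ⟨A', -, rfl⟩ := Finset.mem_image.1 hA
        exact Finset.mem_insert_self _ _
      · intro A hA h
        exact hS' ((Finset.mem_powersetCard.1 hA).1 h)
    rw [e, Finset.card_image_of_injOn, Finset.card_powersetCard, Finset.card_insert_of_notMem hS',
      Nat.add_one_mul_choose_eq, mul_comm]
    intro A hA A' hA' h
    have hA := (Finset.mem_powersetCard.1 (Finset.mem_coe.1 hA)).1
    have hA' := (Finset.mem_powersetCard.1 (Finset.mem_coe.1 hA')).1
    rw [← Finset.erase_insert (fun h => hS' (hA h)), ← Finset.erase_insert (fun h => hS' (hA' h))]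
    exact congrArg (fun B => B.erase t) h

section

variable {ι : Type*} [Fintype ι] [DecidableEq ι] {ρ : ι → Fin 2 → ℝ}

theorem pexp_prod_outcomeSign (hρ1 : ∀ t, ∑ b, ρ t b = 1) (A : Finset ι) :
    pexp ρ (fun b => ∏ t ∈ A, outcomeSign (b t)) = ∏ t ∈ A, (ρ t 0 - ρ t 1) := by
  have h := pexp_prod ρ fun t b => if t ∈ A then outcomeSign b else 1
  have e : ∀ t, (∑ b, ρ t b * if t ∈ A then outcomeSign b else 1)
      = if t ∈ A then ρ t 0 - ρ t 1 else 1 := by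
    intro t
    split_ifs
    · simp [Fin.sum_univ_two, outcomeSign, sub_eq_add_neg]
    · simpa using hρ1 t
  simpa only [e, Finset.prod_ite_mem, Finset.univ_inter] using h

theorem pexp_signStat (hρ1 : ∀ t, ∑ b, ρ t b = 1) {S : Finset ι} {k : ℕ} (hk : k ≤ S.card)
    {μ : ℝ} (hμ : ∀ t ∈ S, ρ t 0 - ρ t 1 = μ) :
    pexp ρ (fun b => signStat k S b) = μ ^ k := by
  have hc : (0 : ℝ) < S.card.choose k := by exact_mod_cast Nat.choose_pos hk
  simp only [signStat, div_eq_inv_mul]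
  rw [pexp_const_mul, pexp_sum, inv_mul_eq_iff_eq_mul₀ hc.ne']
  rw [Finset.sum_congr rfl fun A hA => ?_, Finset.sum_const, Finset.card_powersetCard,
    nsmul_eq_mul]
  rw [pexp_prod_outcomeSign hρ1]
  obtain ⟨hA, hAk⟩ := Finset.mem_powersetCard.1 hA
  rw [Finset.prod_congr rfl fun t ht => hμ t (hA ht), Finset.prod_const, hAk]

/-- Expand the square over pairs of `k`-subsets. Disjoint pairs contribute exactly `μ^(2k)`; the
others contribute at most 1, which is at most the size of their intersection. The sum of all
intersection sizes follows by counting the subsets through each point. -/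
theorem pexp_signStat_sq_le (hρ : ∀ t b, 0 ≤ ρ t b) (hρ1 : ∀ t, ∑ b, ρ t b = 1) {S : Finset ι}
    {k : ℕ} (hk1 : 1 ≤ k) (hk : k ≤ S.card) {μ : ℝ} (hμ : ∀ t ∈ S, ρ t 0 - ρ t 1 = μ) :
    pexp ρ (fun b => signStat k S b ^ 2) ≤ (μ ^ k) ^ 2 + (k : ℝ) ^ 2 / S.card := by
  have hc : (0 : ℝ) < S.card.choose k := by exact_mod_cast Nat.choose_pos hk
  have hS : (0 : ℝ) < S.card := by exact_mod_cast (by omega : 0 < S.card)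
  have e : ∀ b, signStat k S b ^ 2 = ((S.card.choose k : ℝ) ^ 2)⁻¹ *
      ∑ A ∈ S.powersetCard k, ∑ A' ∈ S.powersetCard k,
        (∏ t ∈ A, outcomeSign (b t)) * ∏ t ∈ A', outcomeSign (b t) := by
    intro b
    rw [signStat, div_pow, div_eq_inv_mul, pow_two (Finset.sum _ _), Finset.sum_mul_sum]
  simp only [e]
  rw [pexp_const_mul, pexp_sum]
  simp only [pexp_sum]
  rw [inv_mul_le_iff₀ (by positivity)]
  have pair : ∀ A ∈ S.powersetCard k, ∀ A' ∈ S.powersetCard k,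
      pexp ρ (fun b => (∏ t ∈ A, outcomeSign (b t)) * ∏ t ∈ A', outcomeSign (b t))
        ≤ (μ ^ k) ^ 2 + ∑ t ∈ S, (if t ∈ A then 1 else 0) * (if t ∈ A' then 1 else 0) := by
    intro A hA A' hA'
    obtain ⟨hA, hAk⟩ := Finset.mem_powersetCard.1 hA
    obtain ⟨hA', hAk'⟩ := Finset.mem_powersetCard.1 hA'
    by_cases hd : Disjoint A A'
    · have : ∀ b : ι → Fin 2, (∏ t ∈ A, outcomeSign (b t)) * ∏ t ∈ A', outcomeSign (b t)
          = ∏ t ∈ A ∪ A', outcomeSign (b t) := fun b => (Finset.prod_union hd).symm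
      simp only [this]
      rw [pexp_prod_outcomeSign hρ1,
        Finset.prod_congr rfl fun t ht => hμ t (Finset.union_subset hA hA' ht),
        Finset.prod_const, Finset.card_union_of_disjoint hd, hAk, hAk', pow_add, ← pow_two]
      exact le_add_of_nonneg_right (Finset.sum_nonneg fun t _ => by positivity)
    · obtain ⟨t, htA, htA'⟩ := Finset.not_disjoint_iff.1 hd
      have h1 : (1 : ℝ) ≤ ∑ t ∈ S, (if t ∈ A then 1 else 0) * (if t ∈ A' then 1 else 0) := by
        refine le_trans ?_ (Finset.single_le_sum (fun t _ => by positivity) (hA htA))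
        simp [htA, htA']
      refine (pexp_mono hρ fun b => ?_).trans_eq (pexp_const hρ1 1) |>.trans
        (h1.trans (le_add_of_nonneg_left (by positivity)))
      refine (le_abs_self _).trans ?_
      rw [abs_mul, abs_prod_outcomeSign, abs_prod_outcomeSign, one_mul]
  refine (Finset.sum_le_sum fun A hA => Finset.sum_le_sum fun A' hA' => pair A hA A' hA').trans ?_
  have e2 : ∑ A ∈ S.powersetCard k, ∑ A' ∈ S.powersetCard k,
      ((μ ^ k) ^ 2 + ∑ t ∈ S, (if t ∈ A then (1 : ℝ) else 0) * (if t ∈ A' then 1 else 0))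
      = (S.card.choose k : ℝ) ^ 2 * (μ ^ k) ^ 2
        + ∑ t ∈ S, (((S.powersetCard k).filter fun A => t ∈ A).card : ℝ) ^ 2 := by
    simp only [Finset.sum_add_distrib, Finset.sum_const, Finset.card_powersetCard, nsmul_eq_mul]
    congr 1
    · ring
    · rw [Finset.sum_congr rfl fun A _ => Finset.sum_comm, Finset.sum_comm]
      refine Finset.sum_congr rfl fun t _ => ?_
      rw [← Finset.sum_mul_sum, Finset.sum_boole, pow_two]
  have e3 : ∀ t ∈ S, (((S.powersetCard k).filter fun A => t ∈ A).card : ℝ)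
      = k * S.card.choose k / S.card := by
    intro t ht
    rw [eq_div_iff hS.ne', mul_comm]
    exact_mod_cast card_filter_mem_powersetCard ht k
  rw [e2, Finset.sum_congr rfl fun t ht => by rw [e3 t ht], Finset.sum_const, nsmul_eq_mul]
  apply le_of_eq
  field_simp

/-- The exponential moment of a centred U-statistic of independent signs. -/
theorem pexp_exp_signStat_le (hρ : ∀ t b, 0 ≤ ρ t b) (hρ1 : ∀ t, ∑ b, ρ t b = 1) {S : Finset ι}
    {k : ℕ} (hk1 : 1 ≤ k) (hk : k ≤ S.card) {μ : ℝ} (hμ0 : 0 ≤ μ) (hμ1 : μ ≤ 1)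
    (hμ : ∀ t ∈ S, ρ t 0 - ρ t 1 = μ) (θ : ℝ) :
    pexp ρ (fun b => Real.exp (θ * (signStat k S b - μ ^ k)))
      ≤ Real.exp (θ ^ 2 * Real.exp (2 * |θ|) * min 1 ((k : ℝ) ^ 2 / S.card)) := by
  have hm0 : 0 ≤ μ ^ k := pow_nonneg hμ0 k
  have hm1 : μ ^ k ≤ 1 := pow_le_one₀ hμ0 hμ1
  -- The quadratic bound is expanded in powers of `signStat` so that its expectation involves only
  -- the first two moments. The factor `exp (2 * |θ|)` is available because the deviation is at most
  -- 2.
  have hpt : ∀ b, Real.exp (θ * (signStat k S b - μ ^ k))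
      ≤ 1 + (θ * signStat k S b + (θ ^ 2 * Real.exp (2 * |θ|) * signStat k S b ^ 2
        + ((-2 * μ ^ k * (θ ^ 2 * Real.exp (2 * |θ|))) * signStat k S b
        + (-(θ * μ ^ k) + θ ^ 2 * Real.exp (2 * |θ|) * (μ ^ k) ^ 2)))) := by
    intro b
    refine (exp_le_quadratic _).trans ?_
    have hb := abs_le.1 (abs_signStat_le k S b)
    have : |θ * (signStat k S b - μ ^ k)| ≤ 2 * |θ| := by
      rw [abs_mul, mul_comm 2]
      refine mul_le_mul_of_nonneg_left (abs_le.2 ⟨?_, ?_⟩) (abs_nonneg _) <;> linarith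
    have h2 : (θ * (signStat k S b - μ ^ k)) ^ 2 * Real.exp |θ * (signStat k S b - μ ^ k)|
        ≤ (θ * (signStat k S b - μ ^ k)) ^ 2 * Real.exp (2 * |θ|) := by gcongr
    linarith
  have hE := pexp_signStat hρ1 hk hμ
  have hV := pexp_signStat_sq_le hρ hρ1 hk1 hk hμ
  have hV1 : pexp ρ (fun b => signStat k S b ^ 2) ≤ 1 :=
    (pexp_mono hρ fun b => by
      rw [← sq_abs]; exact pow_le_one₀ (abs_nonneg _) (abs_signStat_le k S b)).trans_eq
      (pexp_const hρ1 1)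
  refine (pexp_mono hρ hpt).trans ?_
  rw [pexp_add, pexp_add, pexp_add, pexp_add, pexp_const hρ1, pexp_const hρ1, pexp_const_mul,
    pexp_const_mul, pexp_const_mul, hE]
  have hτ : 0 ≤ θ ^ 2 * Real.exp (2 * |θ|) := by positivity
  set τ := θ ^ 2 * Real.exp (2 * |θ|)
  set V := pexp ρ (fun b => signStat k S b ^ 2)
  have hmin : V - (μ ^ k) ^ 2 ≤ min 1 ((k : ℝ) ^ 2 / S.card) :=
    le_min (by nlinarith [sq_nonneg (μ ^ k)]) (by linarith)
  calc _ = 1 + τ * (V - (μ ^ k) ^ 2) := by ring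
    _ ≤ 1 + τ * min 1 ((k : ℝ) ^ 2 / S.card) := by gcongr
    _ ≤ _ := by rw [add_comm]; exact Real.add_one_le_exp _

end

/-! ### The labelled U-statistics -/

/-- The sum over the frequent labels of the deviations of their U-statistics from `p`. -/
noncomputable def labelDeviation {Λ : Type*} [Fintype Λ] [DecidableEq Λ] {r : ℕ} (k : ℕ)
    (p : Λ → ℝ) (y : Fin r → Λ) (b : Fin r → Fin 2) : ℝ :=
  ∑ l, often k y l * (signStat k (Finset.univ.filter fun t => y t = l) b - p l)

/-- The variance proxy of `labelDeviation`. -/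
noncomputable def labelVariance {Λ : Type*} [Fintype Λ] [DecidableEq Λ] {r : ℕ} (k : ℕ)
    (y : Fin r → Λ) : ℝ :=
  ∑ l, often k y l * min 1 ((k : ℝ) ^ 2 / count y l)

section

variable {Λ : Type*} [Fintype Λ] [DecidableEq Λ] {ρ : Λ → Fin 2 → ℝ} {μ : Λ → ℝ}

theorem often_nonneg {Λ : Type*} [DecidableEq Λ] {r : ℕ} (k : ℕ) (y : Fin r → Λ) (l : Λ) :
    0 ≤ often k y l := by
  unfold often; split_ifs <;> norm_num

theorem pexp_exp_labelDeviation_le (hρ : ∀ l b, 0 ≤ ρ l b) (hρ1 : ∀ l, ∑ b, ρ l b = 1)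
    (hμ : ∀ l, ρ l 0 - ρ l 1 = μ l) (hμ0 : ∀ l, 0 ≤ μ l) (hμ1 : ∀ l, μ l ≤ 1) {r k : ℕ}
    (hk : 1 ≤ k) (y : Fin r → Λ) (θ : ℝ) :
    pexp (fun t => ρ (y t)) (fun b => Real.exp (θ * labelDeviation k (fun l => μ l ^ k) y b))
      ≤ Real.exp (θ ^ 2 * Real.exp (2 * |θ|) * labelVariance k y) := by
  simp only [labelDeviation, labelVariance, Finset.mul_sum, Real.exp_sum]
  refine (pexp_prod_le (c := 1) (Or.inl rfl) (fun t => ρ (y t)) (fun t => hρ _) (fun t => hρ1 _)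
    (fun l t _ => y t = l) (fun l l' t _ h h' => h ▸ h') _ (fun l x x' h => ?_)
    (fun l x => (Real.exp_pos _).le) Finset.univ).trans ?_
  · have : signStat k (Finset.univ.filter fun t => y t = l) x
        = signStat k (Finset.univ.filter fun t => y t = l) x' := by
      unfold signStat
      congr 1
      refine Finset.sum_congr rfl fun A hA => Finset.prod_congr rfl fun t ht => ?_
      have hyt := (Finset.mem_filter.1 ((Finset.mem_powersetCard.1 hA).1 ht)).2
      by_contra hne
      exact h t (fun e => hne (by rw [e])) hyt
    rw [this]
  · refine Finset.prod_le_prod (fun l _ => pexp_nonneg (fun t => hρ _) fun _ => (Real.exp_pos _).le)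
      fun l _ => ?_
    unfold often
    split_ifs with h
    · simp only [one_mul]
      exact pexp_exp_signStat_le (fun t => hρ _) (fun t => hρ1 _) hk h (hμ0 l) (hμ1 l)
        (fun t ht => by rw [(Finset.mem_filter.1 ht).2, hμ]) θ
    · simp [pexp_const (w := fun t => ρ (y t)) (fun t => hρ1 _)]

variable {u : Λ → ℝ}

theorem pexp_exp_labelVariance_le (hu : ∀ l, 0 ≤ u l) (hu1 : ∑ l, u l = 1) {r k : ℕ} {q : ℝ}
    (hq : ∀ l, binTail (u l) r k = q) (hq0 : 0 ≤ q) {τ : ℝ} (hτ : 0 ≤ τ) :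
    pexp (fun _ : Fin r => u) (fun y => Real.exp (τ * labelVariance k y))
      ≤ Real.exp (Fintype.card Λ * (q * (Real.exp τ - 1))) := by
  refine (pexp_mono (fun _ => hu) (g := fun y => Real.exp (∑ l, τ * often k y l))
    fun y => Real.exp_le_exp.2 ?_).trans
    ((pexp_exp_sum_often_le hu hu1 r k (fun _ => τ) (Or.inl fun _ => hτ)).trans ?_)
  · rw [labelVariance, Finset.mul_sum]
    exact Finset.sum_le_sum fun l _ => mul_le_mul_of_nonneg_left
      (mul_le_of_le_one_right (often_nonneg _ _ _) (min_le_left _ _)) hτ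
  · simp only [hq]
    rw [Finset.prod_const, Real.exp_nat_mul]
    have : 0 ≤ Real.exp τ - 1 := sub_nonneg.2 (Real.one_le_exp hτ)
    refine pow_le_pow_left₀ (by positivity) ?_ _
    rw [add_comm]
    exact Real.add_one_le_exp _

/-- A label seen at least `D` times has variance at most `k² / D`, and any other at most 1. The
labels seen fewer than `D` times enter through `-often D`, so negative association is needed here
with negative coefficients. -/
theorem pexp_exp_labelVariance_le_of_threshold (hu : ∀ l, 0 ≤ u l) (hu1 : ∑ l, u l = 1)
    {r k D : ℕ} (hD : 1 ≤ D) {q : ℝ}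
    (hq : ∀ l, binTail (u l) r D = q) (hq0 : 0 ≤ q) (hq1 : q ≤ 1) {τ : ℝ} (hτ : 0 ≤ τ) :
    pexp (fun _ : Fin r => u) (fun y => Real.exp (τ * labelVariance k y))
      ≤ Real.exp (Fintype.card Λ * ((1 - q) * (Real.exp τ - 1) + τ * ((k : ℝ) ^ 2 / D))) := by
  have hD' : (0 : ℝ) < D := by exact_mod_cast hD
  refine (pexp_mono (fun _ => hu) (g := fun y => Real.exp (Fintype.card Λ *
      (τ + τ * ((k : ℝ) ^ 2 / D))) * Real.exp (∑ l, -τ * often D y l))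
    fun y => ?_).trans ?_
  · rw [← Real.exp_add]
    refine Real.exp_le_exp.2 ?_
    have : (Fintype.card Λ : ℝ) * (τ + τ * ((k : ℝ) ^ 2 / D))
        = ∑ _l : Λ, (τ + τ * ((k : ℝ) ^ 2 / D)) := by
      rw [Finset.sum_const, nsmul_eq_mul]; rfl
    rw [labelVariance, Finset.mul_sum, this, ← Finset.sum_add_distrib]
    refine Finset.sum_le_sum fun l _ => ?_
    have : often k y l * min 1 ((k : ℝ) ^ 2 / count y l) ≤ 1 - often D y l + (k : ℝ) ^ 2 / D := by
      have h1 : often k y l ≤ 1 := by unfold often; split_ifs <;> norm_num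
      have hm : 0 ≤ min 1 ((k : ℝ) ^ 2 / count y l) := le_min zero_le_one (by positivity)
      refine (mul_le_of_le_one_left hm h1).trans ?_
      unfold often
      split_ifs with h
      · refine (min_le_right _ _).trans ?_
        rw [sub_self, zero_add]
        exact div_le_div_of_nonneg_left (by positivity) hD' (by exact_mod_cast h)
      · refine (min_le_left _ _).trans ?_
        rw [sub_zero]
        exact le_add_of_nonneg_right (by positivity)
    nlinarith
  · rw [pexp_const_mul]
    refine (mul_le_mul_of_nonneg_left (pexp_exp_sum_often_le hu hu1 r D (fun _ => -τ)
      (Or.inr fun _ => by linarith)) (Real.exp_pos _).le).trans ?_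
    simp only [hq]
    rw [Finset.prod_const, Real.exp_nat_mul, Real.exp_nat_mul, Finset.card_univ, ← mul_pow]
    have he : Real.exp (-τ) ≤ 1 := by simpa using hτ
    refine pow_le_pow_left₀ (mul_nonneg (Real.exp_pos _).le ?_) ?_ _
    · nlinarith [Real.exp_pos (-τ)]
    · rw [Real.exp_add, Real.exp_add, mul_right_comm]
      refine mul_le_mul_of_nonneg_right ?_ (Real.exp_pos _).le
      have : Real.exp τ * Real.exp (-τ) = 1 := by rw [← Real.exp_add]; simp
      calc _ = (1 - q) * (Real.exp τ - 1) + 1 := by linear_combination q * this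
        _ ≤ _ := Real.add_one_le_exp _

/-- With `G` the mean of `p`, the quantity `∑ J Z - G ∑ J` is a combination of the three controlled
sums, hence at most `3s`. Since `η ≤ 8` gives `s ≤ q v / 4`, the denominator is at least `3 q v /
4`. -/
theorem abs_ratio_sub_mean_le {Λ : Type*} [Fintype Λ] {J Z p : Λ → ℝ} {q η s : ℝ} (hΛ : 0 < Fintype.card Λ) (hq : 0 < q)
    (hη0 : 0 < η) (hη : η ≤ 8) (hp0 : ∀ l, 0 ≤ p l) (hp1 : ∀ l, p l ≤ 1)
    (hs : s = q * Fintype.card Λ * η / 32) (h1 : |∑ l, J l * (Z l - p l)| ≤ s)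
    (h2 : |∑ l, (J l - q) * p l| ≤ s) (h3 : |∑ l, (J l - q) * 1| ≤ s) :
    |(∑ l, J l * Z l) / (∑ l, J l) - (∑ l, p l) / Fintype.card Λ| ≤ η / 4 := by
  have hv : (0 : ℝ) < Fintype.card Λ := by exact_mod_cast hΛ
  set v : ℝ := (Fintype.card Λ : ℝ) with hvdef
  set G := (∑ l, p l) / v with hG
  have hGv : ∑ l, p l = G * v := by rw [hG]; field_simp
  have hG0 : 0 ≤ G := div_nonneg (Finset.sum_nonneg fun l _ => hp0 l) hv.le
  have hG1 : G ≤ 1 := by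
    rw [hG, div_le_one hv]
    refine (Finset.sum_le_sum fun l _ => hp1 l).trans_eq ?_
    rw [Finset.sum_const, nsmul_eq_mul, mul_one]; rfl
  have e3 : ∑ l, (J l - q) * 1 = ∑ l, J l - q * v := by
    simp only [mul_one, Finset.sum_sub_distrib, Finset.sum_const, nsmul_eq_mul]
    rw [mul_comm]; rfl
  have e : ∑ l, J l * Z l - G * ∑ l, J l = ∑ l, J l * (Z l - p l) + ∑ l, (J l - q) * p l
      - G * ∑ l, (J l - q) * 1 := by
    rw [e3]
    simp only [mul_sub, sub_mul, Finset.sum_sub_distrib, ← Finset.mul_sum, hGv]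
    ring
  have hm : q * v - s ≤ ∑ l, J l := by rw [e3] at h3; linarith [(abs_le.1 h3).1]
  have hqv : 0 < q * v := by positivity
  have hm0 : 0 < ∑ l, J l := by nlinarith
  have key : |∑ l, J l * Z l - G * ∑ l, J l| ≤ 3 * s := by
    have hG3 : |G * ∑ l, (J l - q) * 1| ≤ s := by
      rw [abs_mul, abs_of_nonneg hG0]
      exact (mul_le_of_le_one_left (abs_nonneg _) hG1).trans h3
    rw [e]
    rw [abs_le] at *
    constructor <;> linarith
  have e4 : (∑ l, J l * Z l) / (∑ l, J l) - G = (∑ l, J l * Z l - G * ∑ l, J l) / ∑ l, J l := by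
    field_simp
  rw [e4, abs_div, abs_of_pos hm0, div_le_iff₀ hm0]
  have hm1 : q * v * (3 / 4) ≤ ∑ l, J l := by nlinarith
  calc _ ≤ 3 * s := key
    _ ≤ η / 4 * (q * v * (3 / 4)) := by rw [hs]; nlinarith
    _ ≤ _ := by gcongr

theorem pexp_two_sided_le {ι α : Type*} [Fintype ι] [DecidableEq ι] [Fintype α] {w : ι → α → ℝ}
    (hw : ∀ t a, 0 ≤ w t a) (f : (ι → α) → ℝ) {θ : ℝ} (hθ : 0 ≤ θ) (s Ψ : ℝ)
    (h1 : pexp w (fun x => Real.exp (θ * f x)) ≤ Real.exp Ψ)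
    (h2 : pexp w (fun x => Real.exp (-θ * f x)) ≤ Real.exp Ψ) :
    pexp w (fun x => if s < |f x| then 1 else 0) ≤ 2 * Real.exp (-(θ * s) + Ψ) := by
  have a := pexp_indicator_le hw f hθ s
  have b := pexp_indicator_le hw (fun x => -f x) hθ s
  have e : pexp w (fun x => if s < |f x| then 1 else 0)
      ≤ pexp w (fun x => if s < f x then 1 else 0) + pexp w (fun x => if s < -f x then 1 else 0) := by
    rw [← pexp_add]
    refine pexp_mono hw fun x => ?_
    simp only [lt_abs]
    by_cases h : s < f x <;> by_cases h' : s < -f x <;> simp [h, h']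
  simp only [mul_neg, ← neg_mul] at b
  rw [Real.exp_add]
  have hp := Real.exp_pos (-(θ * s))
  simp only [neg_mul] at *
  nlinarith

end

/-! ### Concentration of the estimator for one pair, in two regimes. -/

section

variable {Λ : Type*} [Fintype Λ] [DecidableEq Λ]

/-- The mean of the U-statistics of the frequent labels. -/
noncomputable def labelEst {r : ℕ} (k : ℕ) (x : Fin r → Λ × Fin 2) : ℝ :=
  (∑ l, often k (fun t => (x t).1) l
      * signStat k (Finset.univ.filter fun t => (x t).1 = l) fun t => (x t).2)
    / ∑ l, often k (fun t => (x t).1) l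

variable {u : Λ → ℝ} {ρ : Λ → Fin 2 → ℝ} {μ : Λ → ℝ}

theorem pexp_labelEst_le (hΛ : 0 < Fintype.card Λ) (hu : ∀ l, 0 ≤ u l) (hu1 : ∑ l, u l = 1)
    (hρ : ∀ l b, 0 ≤ ρ l b) (hρ1 : ∀ l, ∑ b, ρ l b = 1) (hμ : ∀ l, ρ l 0 - ρ l 1 = μ l)
    (hμ0 : ∀ l, 0 ≤ μ l) (hμ1 : ∀ l, μ l ≤ 1) {r k : ℕ} (hk : 1 ≤ k) {q : ℝ}
    (hq : ∀ l, binTail (u l) r k = q) (hq0 : 0 < q) (hq1 : q ≤ 1) {η : ℝ} (hη0 : 0 < η)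
    (hη : η ≤ 8) {θ Ψ : ℝ} (hθ : 0 ≤ θ)
    (hΨ : pexp (fun _ : Fin r => u)
      (fun y => Real.exp (θ ^ 2 * Real.exp (2 * θ) * labelVariance k y)) ≤ Real.exp Ψ) :
    pexp (fun (_ : Fin r) (x : Λ × Fin 2) => u x.1 * ρ x.1 x.2)
        (fun x => if η / 4 < |labelEst k x - (∑ l, μ l ^ k) / Fintype.card Λ| then 1 else 0)
      ≤ 2 * Real.exp (-(θ * (q * Fintype.card Λ * η / 32)) + Ψ)
        + 4 * Real.exp (-(θ * (q * Fintype.card Λ * η / 32))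
          + Fintype.card Λ * (q * (1 - q) * θ ^ 2 * Real.exp θ)) := by
  set s : ℝ := q * Fintype.card Λ * η / 32 with hs
  set w : Fin r → Λ × Fin 2 → ℝ := fun _ x => u x.1 * ρ x.1 x.2 with hw
  have hw0 : ∀ t x, 0 ≤ w t x := fun t x => mul_nonneg (hu _) (hρ _ _)
  have hdev : ∀ θ' : ℝ, |θ'| = θ → pexp w (fun x => Real.exp (θ' *
      labelDeviation k (fun l => μ l ^ k) (fun t => (x t).1) fun t => (x t).2)) ≤ Real.exp Ψ := by
    intro θ' h
    rw [hw, pexp_prodMk (fun _ => u) ρ]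
    refine (pexp_mono (fun _ => hu) fun y =>
      pexp_exp_labelDeviation_le hρ hρ1 hμ hμ0 hμ1 hk y θ').trans ?_
    rwa [h, ← sq_abs θ', h]
  -- These sums depend on the labels only, so the signs integrate out. The weights used below are `a
  -- = μ^k` and `a = 1`.
  have hcen : ∀ a : Λ → ℝ, (∀ l, 0 ≤ a l) → (∀ l, a l ≤ 1) → ∀ θ' : ℝ, |θ'| = θ →
      pexp w (fun x => Real.exp (θ' * ∑ l, (often k (fun t => (x t).1) l - q) * a l))
        ≤ Real.exp (Fintype.card Λ * (q * (1 - q) * θ ^ 2 * Real.exp θ)) := by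
    intro a ha0 ha1 θ' h
    rw [hw, pexp_prodMk (fun _ => u) ρ]
    have := pexp_exp_centered_often_le hu hu1 hq hq0.le hq1 a ha0 ha1 θ'
    rw [h, ← sq_abs θ', h] at this
    refine le_trans (le_of_eq ?_) this
    exact congrArg _ (funext fun y => pexp_const (w := fun t => ρ (y t)) (fun t => hρ1 _)
      (Real.exp (θ' * ∑ l, (often k y l - q) * a l)))
  have t1 := pexp_two_sided_le hw0 _ hθ s Ψ (hdev θ (abs_of_nonneg hθ))
    (hdev (-θ) (by rw [abs_neg, abs_of_nonneg hθ]))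
  have hp0 : ∀ l, 0 ≤ μ l ^ k := fun l => pow_nonneg (hμ0 l) k
  have hp1 : ∀ l, μ l ^ k ≤ 1 := fun l => pow_le_one₀ (hμ0 l) (hμ1 l)
  have t2 := pexp_two_sided_le hw0 _ hθ s _ (hcen _ hp0 hp1 θ (abs_of_nonneg hθ))
    (hcen _ hp0 hp1 (-θ) (by rw [abs_neg, abs_of_nonneg hθ]))
  have t3 := pexp_two_sided_le hw0 _ hθ s _
    (hcen (fun _ => 1) (fun _ => zero_le_one) (fun _ => le_rfl) θ (abs_of_nonneg hθ))
    (hcen (fun _ => 1) (fun _ => zero_le_one) (fun _ => le_rfl) (-θ)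
      (by rw [abs_neg, abs_of_nonneg hθ]))
  refine le_trans (b := _ + (_ + _)) ?_ (add_le_add t1 (add_le_add t2 t3)) |>.trans
    (le_of_eq (by ring))
  rw [← pexp_add, ← pexp_add]
  refine pexp_mono hw0 fun x => ?_
  have i0 : ∀ P : Prop, ∀ _ : Decidable P, (0 : ℝ) ≤ if P then 1 else 0 := fun P _ => by
    split_ifs <;> norm_num
  split_ifs with h h1 h2 h3 h3 h2 h3 h3 <;> try norm_num
  rw [not_lt] at h1 h2 h3
  refine absurd h (not_lt.2 ?_)
  exact abs_ratio_sub_mean_le hΛ hq0 hη0 hη hp0 hp1 hs h1 h2 h3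

/-- Each frequent label is charged variance 1. With `θ = η / 256` the linear gain is `η² q v / 8192`
and the quadratic loss at most half of it, which leaves `η² q v / 16384`. -/
theorem pexp_labelEst_le_of_many (hΛ : 0 < Fintype.card Λ) (hu : ∀ l, 0 ≤ u l)
    (hu1 : ∑ l, u l = 1) (hρ : ∀ l b, 0 ≤ ρ l b) (hρ1 : ∀ l, ∑ b, ρ l b = 1)
    (hμ : ∀ l, ρ l 0 - ρ l 1 = μ l) (hμ0 : ∀ l, 0 ≤ μ l) (hμ1 : ∀ l, μ l ≤ 1) {r k : ℕ}
    (hk : 1 ≤ k) {q : ℝ} (hq : ∀ l, binTail (u l) r k = q) (hq0 : 0 < q) (hq1 : q ≤ 1)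
    {η : ℝ} (hη0 : 0 < η) (hη : η ≤ 8) {E : ℝ}
    (hE : 16384 * E ≤ η ^ 2 * (q * Fintype.card Λ)) :
    pexp (fun (_ : Fin r) (x : Λ × Fin 2) => u x.1 * ρ x.1 x.2)
        (fun x => if η / 4 < |labelEst k x - (∑ l, μ l ^ k) / Fintype.card Λ| then 1 else 0)
      ≤ 6 * Real.exp (-E) := by
  have hv : (0 : ℝ) < Fintype.card Λ := by exact_mod_cast hΛ
  have hθ : 0 ≤ η / 256 := by positivity
  have he : Real.exp (2 * (η / 256)) ≤ 2 := by
    have h := Real.abs_exp_sub_one_sub_id_le (x := 2 * (η / 256))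
      (by rw [abs_of_nonneg (by positivity)]; linarith)
    nlinarith [(abs_le.1 h).2]
  have he' : Real.exp (η / 256) ≤ 2 := le_trans (Real.exp_le_exp.2 (by linarith)) he
  set τ := (η / 256) ^ 2 * Real.exp (2 * (η / 256)) with hτdef
  have hτ0 : 0 ≤ τ := by positivity
  have hτ : τ ≤ 2 * (η / 256) ^ 2 := by nlinarith [sq_nonneg (η / 256)]
  have heτ : Real.exp τ - 1 ≤ 2 * τ := by
    have hτ1 : τ ≤ 1 := by nlinarith
    have h := Real.abs_exp_sub_one_sub_id_le (x := τ) (by rwa [abs_of_nonneg hτ0])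
    nlinarith [(abs_le.1 h).2]
  refine (pexp_labelEst_le hΛ hu hu1 hρ hρ1 hμ hμ0 hμ1 hk hq hq0 hq1 hη0 hη hθ
    (pexp_exp_labelVariance_le hu hu1 hq hq0.le hτ0)).trans ?_
  have hqv : 0 < q * Fintype.card Λ := by positivity
  set v : ℝ := (Fintype.card Λ : ℝ) with hvdef
  have b1 : v * (q * (Real.exp τ - 1)) ≤ (q * v) * (4 * (η / 256) ^ 2) := by
    calc _ = (q * v) * (Real.exp τ - 1) := by ring
      _ ≤ _ := mul_le_mul_of_nonneg_left (by linarith) hqv.le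
  have b2 : v * (q * (1 - q) * (η / 256) ^ 2 * Real.exp (η / 256))
      ≤ (q * v) * (4 * (η / 256) ^ 2) := by
    calc _ = (q * v) * ((1 - q) * (Real.exp (η / 256) * (η / 256) ^ 2)) := by ring
      _ ≤ (q * v) * (1 * (2 * (η / 256) ^ 2)) := by
        refine mul_le_mul_of_nonneg_left (mul_le_mul (by linarith)
          (mul_le_mul_of_nonneg_right he' (sq_nonneg _)) (by positivity) zero_le_one) hqv.le
      _ ≤ _ := mul_le_mul_of_nonneg_left (by nlinarith [sq_nonneg (η / 256)]) hqv.le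
  have c : ∀ Ψ : ℝ, Ψ ≤ (q * v) * (4 * (η / 256) ^ 2) →
      Real.exp (-(η / 256 * (q * v * η / 32)) + Ψ) ≤ Real.exp (-E) := by
    intro Ψ h
    exact Real.exp_le_exp.2 (by nlinarith)
  linarith [c _ b1, c _ b2]

/-- For bounded `k`, any rate `B` in the exponent is attainable once nearly every label has a large
count, because both the U-statistics and the indicators then have small variance. With `θ = 128 B η`
and `q ≥ 1 / 2` the linear gain is at least `2 B η² v`; `D` and `κ` are chosen to keep the loss
below `B η² v`. -/
theorem pexp_labelEst_le_of_threshold {B : ℝ} (hB : 1 ≤ B) (k₀ : ℕ) :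
    ∃ (D : ℕ) (κ : ℝ), 0 < κ ∧ ∀ {n : ℕ} {u : Fin n × Fin n → ℝ} {ρ : Fin n × Fin n → Fin 2 → ℝ}
    {μ : Fin n × Fin n → ℝ} (_ : 0 < Fintype.card (Fin n × Fin n)) (_ : ∀ l, 0 ≤ u l)
    (_ : ∑ l, u l = 1) (_ : ∀ l b, 0 ≤ ρ l b) (_ : ∀ l, ∑ b, ρ l b = 1)
    (_ : ∀ l, ρ l 0 - ρ l 1 = μ l) (_ : ∀ l, 0 ≤ μ l) (_ : ∀ l, μ l ≤ 1) {r k : ℕ}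
    (_ : 1 ≤ k) (_ : k ≤ k₀) {p : ℝ} (_ : ∀ l, u l = p)
    {η : ℝ} (_ : 0 < η) (_ : η ≤ 8) (_ : 1 - binTail p r D ≤ κ),
    pexp (fun (_ : Fin r) (x : (Fin n × Fin n) × Fin 2) => u x.1 * ρ x.1 x.2)
        (fun x => if η / 4 < |labelEst k x - (∑ l, μ l ^ k) / Fintype.card (Fin n × Fin n)|
          then 1 else 0)
      ≤ 6 * Real.exp (-(B * (η ^ 2 * Fintype.card (Fin n × Fin n)))) := by
  set x : ℝ := 128 * B with hx
  have hx0 : 0 < x := by linarith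
  -- Since `η ≤ 8`, `η² Y` bounds `τ = θ² exp (2θ)` for `θ = x η`, and `64 Y` bounds it uniformly in
  -- `η`.
  set Y : ℝ := x ^ 2 * Real.exp (16 * x) with hY
  have hY0 : 0 < Y := by positivity
  have hY1 : 1 ≤ Y := by
    have : 1 ≤ Real.exp (16 * x) := Real.one_le_exp (by positivity)
    nlinarith [sq_nonneg x]
  obtain ⟨D₀, hD₀⟩ := exists_nat_gt (2 * Y * k₀ ^ 2)
  refine ⟨D₀ + k₀ + 1, 1 / (2 * Y * Real.exp (64 * Y)), by positivity, ?_⟩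
  intro n u ρ μ hΛ hu hu1 hρ hρ1 hμ hμ0 hμ1 r k hk hkk p hp η hη0 hη hκ
  set D := D₀ + k₀ + 1 with hD
  have hv : (0 : ℝ) < Fintype.card (Fin n × Fin n) := by exact_mod_cast hΛ
  have hne : Nonempty (Fin n × Fin n) := Fintype.card_pos_iff.1 hΛ
  obtain ⟨l₀⟩ := hne
  have hp0 : 0 ≤ p := hp l₀ ▸ hu l₀
  have hp1 : p ≤ 1 := by
    rw [← hp l₀, ← hu1]
    exact Finset.single_le_sum (fun l _ => hu l) (Finset.mem_univ l₀)
  have hqq := binTail_antitone hp0 hp1 r (by omega : k ≤ D)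
  have hqD0 := binTail_nonneg hp0 hp1 r D
  have hqD1 := binTail_le_one hp0 hp1 r D
  have hq1 := binTail_le_one hp0 hp1 r k
  have hD1 : 1 ≤ D := by omega
  have hkD : (k : ℝ) ^ 2 / D * Y ≤ 1 / 2 := by
    have hD' : (D₀ : ℝ) < D := by exact_mod_cast (by omega : D₀ < D)
    have hkk' : (k : ℝ) ^ 2 ≤ k₀ ^ 2 := by
      have : (k : ℝ) ≤ k₀ := by exact_mod_cast hkk
      gcongr
    rw [div_mul_eq_mul_div, div_le_iff₀ (lt_of_le_of_lt (Nat.cast_nonneg _) hD')]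
    nlinarith
  set q := binTail p r k with hqdef
  set q' := binTail p r D with hqdef'
  clear_value q q' Y x D
  have he1 : 1 ≤ Real.exp (64 * Y) := Real.one_le_exp (by positivity)
  have hκ' : (1 - q') * (Y * Real.exp (64 * Y)) ≤ 1 / 2 := by
    calc _ ≤ 1 / (2 * Y * Real.exp (64 * Y)) * (Y * Real.exp (64 * Y)) := by gcongr
      _ = _ := by field_simp
  have h1q' : 0 ≤ 1 - q' := by linarith
  have hκY : (1 - q') * Y ≤ 1 / 2 := by
    refine le_trans ?_ hκ'
    exact mul_le_mul_of_nonneg_left (le_mul_of_one_le_right hY0.le he1) h1q'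
  have hqhalf : 1 / 2 ≤ q := by nlinarith
  have hθ : 0 ≤ x * η := by positivity
  set τ := (x * η) ^ 2 * Real.exp (2 * (x * η)) with hτdef
  have hτ0 : 0 ≤ τ := by positivity
  have hτ : τ ≤ η ^ 2 * Y := by
    have : Real.exp (2 * (x * η)) ≤ Real.exp (16 * x) := Real.exp_le_exp.2 (by nlinarith)
    calc τ = η ^ 2 * (x ^ 2 * Real.exp (2 * (x * η))) := by rw [hτdef]; ring
      _ ≤ _ := by rw [hY]; gcongr
  have hτ64 : τ ≤ 64 * Y := hτ.trans (mul_le_mul_of_nonneg_right (by nlinarith) hY0.le)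
  have heτ : Real.exp τ - 1 ≤ η ^ 2 * (Y * Real.exp (64 * Y)) := by
    have h1 : Real.exp τ - 1 ≤ τ * Real.exp τ := by
      have := Real.add_one_le_exp (-τ)
      have h2 : Real.exp τ * Real.exp (-τ) = 1 := by rw [← Real.exp_add]; simp
      nlinarith [Real.exp_pos τ]
    calc _ ≤ τ * Real.exp τ := h1
      _ ≤ (η ^ 2 * Y) * Real.exp (64 * Y) := by gcongr
      _ = _ := by ring
  refine (pexp_labelEst_le hΛ hu hu1 hρ hρ1 hμ hμ0 hμ1 hk (q := q)
    (fun l => by rw [hp l, ← hqdef]) (by linarith) hq1 hη0 hη hθ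
    (pexp_exp_labelVariance_le_of_threshold hu hu1 hD1 (q := q')
      (fun l => by rw [hp l, ← hqdef'])
      hqD0 hqD1 hτ0)).trans ?_
  set v : ℝ := (Fintype.card (Fin n × Fin n) : ℝ) with hvdef
  clear_value τ v
  have hBη : 0 ≤ B * (η ^ 2 * v) := by positivity
  have hηv : 0 ≤ η ^ 2 * v := by positivity
  have b1 : v * ((1 - q') * (Real.exp τ - 1) + τ * ((k : ℝ) ^ 2 / D)) ≤ B * (η ^ 2 * v) := by
    calc _ ≤ v * ((1 - q') * (η ^ 2 * (Y * Real.exp (64 * Y))) + η ^ 2 * Y * ((k : ℝ) ^ 2 / D)) := by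
          gcongr
      _ = η ^ 2 * v * ((1 - q') * (Y * Real.exp (64 * Y)) + (k : ℝ) ^ 2 / D * Y) := by ring
      _ ≤ η ^ 2 * v * 1 := by
          refine mul_le_mul_of_nonneg_left ?_ hηv
          linarith
      _ ≤ _ := by rw [mul_one]; exact le_mul_of_one_le_left hηv hB
  have b2 : v * (q * (1 - q) * (x * η) ^ 2 * Real.exp (x * η)) ≤ B * (η ^ 2 * v) := by
    have h1q : 0 ≤ 1 - q := by linarith
    have hexp : Real.exp (x * η) ≤ Real.exp (2 * (x * η)) := Real.exp_le_exp.2 (by linarith)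
    calc _ = v * (q * ((1 - q) * ((x * η) ^ 2 * Real.exp (x * η)))) := by ring
      _ ≤ v * (1 * ((1 - q') * τ)) := by
          have hAτ : (x * η) ^ 2 * Real.exp (x * η) ≤ τ := by
            rw [hτdef]; exact mul_le_mul_of_nonneg_left hexp (sq_nonneg _)
          have hA : 0 ≤ (x * η) ^ 2 * Real.exp (x * η) := by positivity
          exact mul_le_mul_of_nonneg_left (mul_le_mul hq1
            (mul_le_mul (by linarith) hAτ hA h1q') (mul_nonneg h1q hA) zero_le_one) hv.le
      _ ≤ v * (1 * ((1 - q') * (η ^ 2 * Y))) :=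
          mul_le_mul_of_nonneg_left (mul_le_mul_of_nonneg_left
            (mul_le_mul_of_nonneg_left hτ h1q') zero_le_one) hv.le
      _ = η ^ 2 * v * ((1 - q') * Y) := by ring
      _ ≤ η ^ 2 * v * 1 := by
          refine mul_le_mul_of_nonneg_left ?_ hηv
          linarith
      _ ≤ _ := by rw [mul_one]; exact le_mul_of_one_le_left hηv hB
  have c : ∀ Ψ : ℝ, Ψ ≤ B * (η ^ 2 * v) →
      Real.exp (-(x * η * (q * v * η / 32)) + Ψ) ≤ Real.exp (-(B * (η ^ 2 * v))) := by
    intro Ψ h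
    refine Real.exp_le_exp.2 ?_
    have : x * η * (q * v * η / 32) = 4 * q * (B * (η ^ 2 * v)) := by rw [hx]; ring
    have h2 : 2 * (B * (η ^ 2 * v)) ≤ 4 * q * (B * (η ^ 2 * v)) :=
      mul_le_mul_of_nonneg_right (by linarith) hBη
    rw [this]
    linarith
  rw [← hτdef]
  linarith [c _ b1, c _ b2]

end

/-! ### Fidelities within a ball -/

section fidelity

variable {d : ℕ}

theorem fidelity_nonneg (ψ φ : PureState d) : 0 ≤ fidelity ψ φ := sq_nonneg _

theorem fidelity_comm (ψ φ : PureState d) : fidelity ψ φ = fidelity φ ψ := by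
  rw [fidelity, fidelity, norm_inner_symm]

theorem norm_inner_pureState_le (ψ φ : PureState d) : ‖inner ℂ ψ.1 φ.1‖ ≤ 1 := by
  simpa [ψ.2, φ.2] using norm_inner_le_norm (𝕜 := ℂ) ψ.1 φ.1

theorem fidelity_le_one (ψ φ : PureState d) : fidelity ψ φ ≤ 1 :=
  pow_le_one₀ (norm_nonneg _) (norm_inner_pureState_le ψ φ)

/-- Split `ψ` into its component along `χ`, whose coefficient has modulus at most 1, and an
orthogonal remainder of squared norm `1 - fidelity ψ χ`. -/
theorem norm_inner_le_add_of_ball {ψ χ : PureState d} {e : ℝ} (h : 1 - fidelity ψ χ ≤ e)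
    (φ : PureState d) : ‖inner ℂ ψ.1 φ.1‖ ≤ ‖inner ℂ χ.1 φ.1‖ + Real.sqrt e := by
  set c : ℂ := inner ℂ χ.1 ψ.1 with hc
  set w := ψ.1 - c • χ.1 with hw
  have hcc : ‖c‖ ^ 2 = fidelity ψ χ := by rw [fidelity, hc, norm_inner_symm]
  have hχχ : inner ℂ χ.1 χ.1 = (1 : ℂ) := by
    rw [inner_self_eq_norm_sq_to_K, χ.2]; simp
  have horth : inner ℂ (c • χ.1) w = (0 : ℂ) := by
    rw [hw, inner_sub_right, inner_smul_left, inner_smul_left, inner_smul_right, hχχ, ← hc]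
    ring
  have hwn : ‖w‖ ^ 2 = 1 - fidelity ψ χ := by
    have hψ : ψ.1 = c • χ.1 + w := by rw [hw]; abel
    have h2 := norm_add_sq_eq_norm_sq_add_norm_sq_of_inner_eq_zero (c • χ.1) w horth
    rw [← hψ, ψ.2, norm_smul, χ.2] at h2
    rw [← hcc]
    nlinarith
  have hws : ‖w‖ ≤ Real.sqrt e := Real.le_sqrt_of_sq_le (by rw [hwn]; exact h)
  have hψ : inner ℂ ψ.1 φ.1 = inner ℂ (c • χ.1) φ.1 + inner ℂ w φ.1 := by
    rw [← inner_add_left, hw, add_sub_cancel]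
  rw [hψ]
  refine (norm_add_le _ _).trans (add_le_add ?_ ?_)
  · rw [inner_smul_left, norm_mul, RCLike.norm_conj]
    exact mul_le_of_le_one_left (norm_nonneg _) (norm_inner_pureState_le χ ψ)
  · refine (norm_inner_le_norm _ _).trans ?_
    rwa [φ.2, mul_one]

theorem abs_fidelity_sub_le {ψ χ : PureState d} {e : ℝ} (h : 1 - fidelity ψ χ ≤ e)
    (φ : PureState d) : |fidelity ψ φ - fidelity χ φ| ≤ 2 * Real.sqrt e := by
  have h1 := norm_inner_le_add_of_ball h φ
  have h2 := norm_inner_le_add_of_ball (ψ := χ) (χ := ψ) (e := e) (by rwa [fidelity_comm]) φ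
  have a := norm_inner_pureState_le ψ φ
  have b := norm_inner_pureState_le χ φ
  have e0 : fidelity ψ φ - fidelity χ φ = (‖inner ℂ ψ.1 φ.1‖ - ‖inner ℂ χ.1 φ.1‖)
      * (‖inner ℂ ψ.1 φ.1‖ + ‖inner ℂ χ.1 φ.1‖) := by rw [fidelity, fidelity]; ring
  rw [e0, abs_mul, mul_comm 2]
  refine mul_le_mul (abs_le.2 ⟨by linarith, by linarith⟩) ?_ (abs_nonneg _) (Real.sqrt_nonneg _)
  rw [abs_of_nonneg (by positivity)]
  linarith

end fidelity

/-! ### The law of a sample -/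

section groups

variable {d N n : ℕ}

/-- The pairs of states with label `l`. -/
def labelFiber (g g' : Fin N → Fin n) (l : Fin n × Fin n) : Finset (Fin N × Fin N) :=
  Finset.univ.filter fun ij => (g ij.1, g' ij.2) = l

/-- The mean fidelity of the pairs of states with label `l`. -/
noncomputable def labelFidelity (E E' : Ensemble d N) (g g' : Fin N → Fin n)
    (l : Fin n × Fin n) : ℝ :=
  (∑ ij ∈ labelFiber g g' l, fidelity (E ij.1) (E' ij.2)) / (labelFiber g g' l).card

variable (E E' : Ensemble d N) (g g' : Fin N → Fin n)

theorem labelFidelity_nonneg (l : Fin n × Fin n) : 0 ≤ labelFidelity E E' g g' l :=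
  div_nonneg (Finset.sum_nonneg fun _ _ => fidelity_nonneg _ _) (Nat.cast_nonneg _)

theorem labelFidelity_le_one (l : Fin n × Fin n) : labelFidelity E E' g g' l ≤ 1 := by
  refine div_le_one_of_le₀ ((Finset.sum_le_sum fun _ _ => fidelity_le_one _ _).trans_eq ?_)
    (Nat.cast_nonneg _)
  simp

variable {E E' g g'}

theorem card_labelFiber (hg : ∀ a, n * (Finset.univ.filter fun i => g i = a).card = N)
    (hg' : ∀ a, n * (Finset.univ.filter fun i => g' i = a).card = N) (l : Fin n × Fin n) :
    (n : ℝ) ^ 2 * (labelFiber g g' l).card = (N : ℝ) ^ 2 := by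
  have e : labelFiber g g' l = (Finset.univ.filter fun i => g i = l.1)
      ×ˢ (Finset.univ.filter fun i => g' i = l.2) := by
    ext ij; simp [labelFiber, Prod.ext_iff]
  rw [e, Finset.card_product]
  have h1 : (n : ℝ) * (Finset.univ.filter fun i => g i = l.1).card = N := by exact_mod_cast hg l.1
  have h2 : (n : ℝ) * (Finset.univ.filter fun i => g' i = l.2).card = N := by
    exact_mod_cast hg' l.2
  push_cast
  linear_combination (n * (Finset.univ.filter fun i => g' i = l.2).card : ℝ) * h1 + (N : ℝ) * h2

/-- Moving both states to their centres costs `2√e` each. Two pairs with one label share their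
centres, so their fidelities differ by at most `8√e`; then average over the fibre. -/
theorem abs_labelFidelity_sub_le [NeZero N] {e : ℝ} (G : BallGrouping E n e)
    (G' : BallGrouping E' n e) (ij : Fin N × Fin N) :
    |fidelity (E ij.1) (E' ij.2) - labelFidelity E E' G.ball G'.ball (G.ball ij.1, G'.ball ij.2)|
      ≤ 8 * Real.sqrt e := by
  have hc : ∀ ij' : Fin N × Fin N, |fidelity (E ij'.1) (E' ij'.2)
      - fidelity (G.center (G.ball ij'.1)) (G'.center (G'.ball ij'.2))| ≤ 4 * Real.sqrt e := by
    intro ij'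
    have h1 := abs_fidelity_sub_le (G.mem_ball ij'.1) (E' ij'.2)
    have h2 := abs_fidelity_sub_le (G'.mem_ball ij'.2) (G.center (G.ball ij'.1))
    rw [fidelity_comm (E' _), fidelity_comm (G'.center _)] at h2
    rw [abs_le] at *
    constructor <;> linarith
  set l := (G.ball ij.1, G'.ball ij.2) with hl
  have hmem : ij ∈ labelFiber G.ball G'.ball l := by simp [labelFiber, hl]
  have hcard : (0 : ℝ) < (labelFiber G.ball G'.ball l).card := by
    exact_mod_cast Finset.card_pos.2 ⟨ij, hmem⟩
  have e1 : fidelity (E ij.1) (E' ij.2) - labelFidelity E E' G.ball G'.ball l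
      = (∑ ij' ∈ labelFiber G.ball G'.ball l,
          (fidelity (E ij.1) (E' ij.2) - fidelity (E ij'.1) (E' ij'.2)))
        / (labelFiber G.ball G'.ball l).card := by
    rw [labelFidelity, Finset.sum_sub_distrib, Finset.sum_const, nsmul_eq_mul, sub_div,
      mul_div_cancel_left₀ _ hcard.ne']
  rw [e1, abs_div, Nat.abs_cast, div_le_iff₀ hcard]
  refine (Finset.abs_sum_le_sum_abs _ _).trans
    ((Finset.sum_le_card_nsmul _ _ (8 * Real.sqrt e) fun ij' h => ?_).trans_eq
      (by rw [nsmul_eq_mul, mul_comm]))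
  have h1 := hc ij
  have h2 := hc ij'
  have hll : (G.ball ij'.1, G'.ball ij'.2) = (G.ball ij.1, G'.ball ij.2) :=
    (Finset.mem_filter.1 h).2
  obtain ⟨hl1, hl2⟩ := Prod.mk.inj hll
  rw [hl1, hl2] at h2
  rw [abs_le] at *
  constructor <;> linarith

theorem abs_meanFidelity_sub_le [NeZero N] {e : ℝ} (G : BallGrouping E n e)
    (G' : BallGrouping E' n e) (hn : 0 < n) (k : ℕ) :
    |meanFidelity k E E'
      - (∑ l, labelFidelity E E' G.ball G'.ball l ^ k) / (n : ℝ) ^ 2| ≤ 8 * k * Real.sqrt e := by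
  have hN : (0 : ℝ) < (N : ℝ) ^ 2 := by
    have : (0 : ℝ) < N := by exact_mod_cast Nat.pos_of_ne_zero (NeZero.ne N)
    positivity
  have hn' : (0 : ℝ) < (n : ℝ) ^ 2 := by
    have : (0 : ℝ) < n := by exact_mod_cast hn
    positivity
  set F := labelFidelity E E' G.ball G'.ball with hF
  have e1 : (∑ l, F l ^ k) / (n : ℝ) ^ 2
      = (∑ ij : Fin N × Fin N, F (G.ball ij.1, G'.ball ij.2) ^ k) / (N : ℝ) ^ 2 := by
    rw [← Finset.sum_fiberwise Finset.univ (fun ij : Fin N × Fin N => (G.ball ij.1, G'.ball ij.2)),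
      div_eq_div_iff hn'.ne' hN.ne', Finset.sum_mul, Finset.sum_mul]
    refine Finset.sum_congr rfl fun l _ => ?_
    rw [Finset.sum_congr rfl fun ij h => by rw [(Finset.mem_filter.1 h).2], Finset.sum_const,
      nsmul_eq_mul, ← card_labelFiber G.uniform G'.uniform l, labelFiber]
    ring
  rw [e1, meanFidelity, ← Fintype.sum_prod_type', ← sub_div, ← Finset.sum_sub_distrib, abs_div,
    abs_of_pos hN, div_le_iff₀ hN]
  refine (Finset.abs_sum_le_sum_abs _ _).trans
    ((Finset.sum_le_card_nsmul _ _ (8 * k * Real.sqrt e) fun ij _ => ?_).trans_eq ?_)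
  · refine (abs_pow_sub_pow_le _ _ k).trans ?_
    have h := abs_labelFidelity_sub_le G G' ij
    have hmax : max |fidelity (E ij.1) (E' ij.2)| |F (G.ball ij.1, G'.ball ij.2)| ≤ 1 := by
      rw [abs_of_nonneg (fidelity_nonneg _ _), abs_of_nonneg (labelFidelity_nonneg _ _ _ _ _)]
      exact max_le (fidelity_le_one _ _) (labelFidelity_le_one _ _ _ _ _)
    have hp := pow_le_one₀ (n := k - 1) (le_max_of_le_left (abs_nonneg _)) hmax
    calc _ ≤ 8 * Real.sqrt e * k * 1 := by gcongr
      _ = _ := by ring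
  · rw [Finset.card_univ, Fintype.card_prod, Fintype.card_fin, nsmul_eq_mul]
    push_cast
    ring

/-- The law of the outcome given the label. -/
noncomputable def outcomeWeight (E E' : Ensemble d N) (g g' : Fin N → Fin n) (l : Fin n × Fin n)
    (b : Fin 2) : ℝ :=
  (1 + (-1) ^ (b : ℕ) * labelFidelity E E' g g' l) / 2

theorem outcomeWeight_nonneg (l : Fin n × Fin n) (b : Fin 2) : 0 ≤ outcomeWeight E E' g g' l b := by
  have h0 := labelFidelity_nonneg E E' g g' l
  have h1 := labelFidelity_le_one E E' g g' l
  unfold outcomeWeight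
  fin_cases b <;> simp <;> linarith

theorem sum_outcomeWeight (l : Fin n × Fin n) : ∑ b, outcomeWeight E E' g g' l b = 1 := by
  simp [outcomeWeight, Fin.sum_univ_two]; ring

theorem outcomeWeight_sub (l : Fin n × Fin n) :
    outcomeWeight E E' g g' l 0 - outcomeWeight E E' g g' l 1 = labelFidelity E E' g g' l := by
  simp [outcomeWeight]; ring

/-- All label fibres have `N² / n²` pairs, and the SWAP-test probability is affine in the fidelity,
so averaging over a fibre replaces the fidelity by its mean. -/
theorem toReal_sampleLaw [NeZero N] (hn : 0 < n)
    (hg : ∀ a, n * (Finset.univ.filter fun i => g i = a).card = N)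
    (hg' : ∀ a, n * (Finset.univ.filter fun i => g' i = a).card = N) (x : Sample n) :
    (sampleLaw E E' g g' x).toReal = 1 / (n : ℝ) ^ 2 * outcomeWeight E E' g g' x.1 x.2 := by
  obtain ⟨l, b⟩ := x
  have hN : (0 : ℝ) < (N : ℝ) ^ 2 := by
    have : (0 : ℝ) < N := by exact_mod_cast Nat.pos_of_ne_zero (NeZero.ne N)
    positivity
  have hn' : (0 : ℝ) < (n : ℝ) ^ 2 := by
    have : (0 : ℝ) < n := by exact_mod_cast hn
    positivity
  have hinner : ∀ ij : Fin N × Fin N,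
      ((swapTest (E ij.1) (E' ij.2)).map fun b => ((g ij.1, g' ij.2), b)) (l, b)
        = if (g ij.1, g' ij.2) = l then ENNReal.ofReal (swapTestProb (E ij.1) (E' ij.2) b) else 0 := by
    intro ij
    rw [PMF.map_apply, tsum_fintype]
    split_ifs with h
    · rw [Finset.sum_eq_single b]
      · simp [h, swapTest]
      · intro b' _ hb'
        rw [if_neg]
        intro h'
        exact hb' (Prod.ext_iff.1 h').2.symm
      · simp
    · refine Finset.sum_eq_zero fun b' _ => if_neg fun h' => h (Prod.ext_iff.1 h').1.symm
  rw [sampleLaw, PMF.bind_apply, tsum_fintype, ENNReal.toReal_sum]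
  swap
  · intro ij _
    rw [hinner]
    refine ENNReal.mul_ne_top (PMF.apply_ne_top _ _) ?_
    split_ifs <;> simp
  have e : ∀ ij : Fin N × Fin N, ((PMF.uniformOfFintype (Fin N × Fin N)) ij *
      ((swapTest (E ij.1) (E' ij.2)).map fun b => ((g ij.1, g' ij.2), b)) (l, b)).toReal
      = if (g ij.1, g' ij.2) = l then
          ((N : ℝ) ^ 2)⁻¹ * ((1 + (-1) ^ (b : ℕ) * fidelity (E ij.1) (E' ij.2)) / 2) else 0 := by
    intro ij
    rw [hinner, PMF.uniformOfFintype_apply, ENNReal.toReal_mul]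
    split_ifs with h
    · rw [ENNReal.toReal_ofReal (swapTestProb_nonneg _ _ _), swapTestProb_eq]
      simp [pow_two]
    · simp
  simp only [e]
  rw [← Finset.sum_filter, ← Finset.mul_sum, ← Finset.sum_div, Finset.sum_add_distrib,
    ← Finset.mul_sum]
  have hc := card_labelFiber hg hg' l
  have hc0 : (0 : ℝ) < (labelFiber g g' l).card := by
    by_contra h
    nlinarith
  have hsum : ∑ ij ∈ labelFiber g g' l, fidelity (E ij.1) (E' ij.2)
      = (labelFiber g g' l).card * labelFidelity E E' g g' l := by
    rw [labelFidelity]; field_simp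
  have hfil : (Finset.univ.filter fun ij : Fin N × Fin N => (g ij.1, g' ij.2) = l)
      = labelFiber g g' l := rfl
  rw [hfil, hsum, outcomeWeight, ← hc]
  simp only [Finset.sum_const, nsmul_eq_mul, mul_one]
  field_simp

/-! ### The law of the data -/

instance [NeZero N] (r : ℕ) (E E' : Ensemble d N) (g g' : Fin N → Fin n) :
    MeasureTheory.IsProbabilityMeasure (dataLaw r E E' g g') := by
  unfold dataLaw; infer_instance

open Classical in
theorem dataLaw_apply [NeZero N] (hn : 0 < n)
    (hg : ∀ a, n * (Finset.univ.filter fun i => g i = a).card = N)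
    (hg' : ∀ a, n * (Finset.univ.filter fun i => g' i = a).card = N) (r : ℕ)
    (A : Set (Fin r → Sample n)) :
    dataLaw r E E' g g' A = ENNReal.ofReal (pexp
      (fun (_ : Fin r) (x : Sample n) => 1 / (n : ℝ) ^ 2 * outcomeWeight E E' g g' x.1 x.2)
      (fun x => if x ∈ A then 1 else 0)) := by
  have h1 : dataLaw r E E' g g' A
      = ∑ x ∈ Finset.univ.filter (fun x => x ∈ A), dataLaw r E E' g g' {x} := by
    rw [MeasureTheory.sum_measure_singleton]; simp
  have h2 : ∀ x, dataLaw r E E' g g' {x} = ENNReal.ofReal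
      (∏ t, (1 / (n : ℝ) ^ 2 * outcomeWeight E E' g g' (x t).1 (x t).2)) := by
    intro x
    rw [dataLaw, MeasureTheory.Measure.pi_singleton, ENNReal.ofReal_prod_of_nonneg]
    · refine Finset.prod_congr rfl fun t _ => ?_
      rw [PMF.toMeasure_apply_singleton _ _ (MeasurableSet.singleton _),
        ← toReal_sampleLaw hn hg hg', ENNReal.ofReal_toReal (PMF.apply_ne_top _ _)]
    · exact fun t _ => mul_nonneg (by positivity) (outcomeWeight_nonneg _ _)
  rw [h1, pexp]
  simp only [h2, mul_ite, mul_one, mul_zero]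
  rw [← Finset.sum_filter, ENNReal.ofReal_sum_of_nonneg]
  exact fun x _ => Finset.prod_nonneg fun t _ =>
    mul_nonneg (by positivity) (outcomeWeight_nonneg _ _)

/-- A union bound over the three data sets; the coefficients 1, 1, 2 add up to 4, whence `η / 4` and
`4 * β`. -/
theorem failureProb_le [NeZero N] {k M : ℕ} {ε η β : ℝ} {E₁ E₂ : Ensemble d N}
    {g₁ g₂ : Fin N → Fin n} {m₁₁ m₂₂ m₁₂ : ℝ} (hε : ε = η + 4 * β)
    (h₁₁ : |meanFidelity k E₁ E₁ - m₁₁| ≤ β) (h₂₂ : |meanFidelity k E₂ E₂ - m₂₂| ≤ β)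
    (h₁₂ : |meanFidelity k E₁ E₂ - m₁₂| ≤ β) {P : ℝ≥0∞}
    (p₁₁ : dataLaw (M / 3) E₁ E₁ g₁ g₁ {x | η / 4 < |meanFidelityEst k x - m₁₁|} ≤ P)
    (p₂₂ : dataLaw (M / 3) E₂ E₂ g₂ g₂ {x | η / 4 < |meanFidelityEst k x - m₂₂|} ≤ P)
    (p₁₂ : dataLaw (M / 3) E₁ E₂ g₁ g₂ {x | η / 4 < |meanFidelityEst k x - m₁₂|} ≤ P) :
    failureProb k M ε E₁ E₂ g₁ g₂ ≤ P + (P + P) := by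
  set A₁ := {x : Fin (M / 3) → Sample n | η / 4 < |meanFidelityEst k x - m₁₁|}
  set A₂ := {x : Fin (M / 3) → Sample n | η / 4 < |meanFidelityEst k x - m₂₂|}
  set A₃ := {x : Fin (M / 3) → Sample n | η / 4 < |meanFidelityEst k x - m₁₂|}
  have hsub : {x : (Fin (M / 3) → Sample n) × (Fin (M / 3) → Sample n) × (Fin (M / 3) → Sample n) |
      ε < |mmdEst k x - mmd k E₁ E₂|}
      ⊆ A₁ ×ˢ Set.univ ∪ (Set.univ ×ˢ (A₂ ×ˢ Set.univ) ∪ Set.univ ×ˢ (Set.univ ×ˢ A₃)) := by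
    intro x hx
    by_contra hnot
    simp only [Set.mem_union, Set.mem_prod, Set.mem_univ, true_and, and_true, not_or] at hnot
    obtain ⟨a, b, c⟩ := hnot
    simp only [A₁, A₂, A₃, Set.mem_ofPred_eq, not_lt] at a b c hx
    refine absurd hx (not_lt.2 ?_)
    rw [mmdEst, mmd]
    rw [abs_le] at *
    constructor <;> linarith
  refine (MeasureTheory.measure_mono hsub).trans ((MeasureTheory.measure_union_le _ _).trans
    (add_le_add ?_ ((MeasureTheory.measure_union_le _ _).trans (add_le_add ?_ ?_))))
  · rw [MeasureTheory.Measure.prod_prod, MeasureTheory.measure_univ, mul_one]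
    exact p₁₁
  · rw [MeasureTheory.Measure.prod_prod, MeasureTheory.Measure.prod_prod,
      MeasureTheory.measure_univ, MeasureTheory.measure_univ, mul_one, one_mul]
    exact p₂₂
  · rw [MeasureTheory.Measure.prod_prod, MeasureTheory.Measure.prod_prod,
      MeasureTheory.measure_univ, MeasureTheory.measure_univ, one_mul, one_mul]
    exact p₁₂

end groups

/-! ### Sample complexity for one pair of ensembles -/

theorem meanFidelityEst_eq_labelEst {n r : ℕ} (k : ℕ) (x : Fin r → Sample n) :
    meanFidelityEst k x = labelEst k x := by
  rw [meanFidelityEst, labelEst, goodLabels, Finset.sum_filter, Finset.card_filter]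
  push_cast
  congr 1
  refine Finset.sum_congr rfl fun l _ => ?_
  rw [← boole_mul]
  rfl

theorem abs_meanFidelityEst_le {n r : ℕ} (k : ℕ) (x : Fin r → Sample n) :
    |meanFidelityEst k x| ≤ 1 := by
  rw [meanFidelityEst, abs_div, Nat.abs_cast]
  refine div_le_one_of_le₀ ((Finset.abs_sum_le_sum_abs _ _).trans ?_) (Nat.cast_nonneg _)
  refine (Finset.sum_le_card_nsmul _ _ (1 : ℝ) fun l _ =>
    abs_signStat_le k _ fun t => (x t).2).trans_eq ?_
  simp

theorem meanFidelity_nonneg {d N : ℕ} (k : ℕ) (E E' : Ensemble d N) : 0 ≤ meanFidelity k E E' :=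
  div_nonneg (Finset.sum_nonneg fun _ _ => Finset.sum_nonneg fun _ _ =>
    pow_nonneg (fidelity_nonneg _ _) _) (by positivity)

theorem meanFidelity_le_one {d N : ℕ} (k : ℕ) (E E' : Ensemble d N) : meanFidelity k E E' ≤ 1 := by
  refine div_le_one_of_le₀ ((Finset.sum_le_sum fun i _ => Finset.sum_le_sum fun j _ =>
    pow_le_one₀ (fidelity_nonneg _ _) (fidelity_le_one _ _)).trans_eq ?_) (by positivity)
  simp [pow_two]

/-- Lower bound for the probability that a label occurs at least `k` times. -/
theorem le_binTail_one_div {v : ℝ} (hv : 1 ≤ v) {r k : ℕ} (hrk : 2 * k ≤ r) :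
    ((r : ℝ) / (4 * v)) ^ k / k.factorial * Real.exp (-(r / v)) ≤ binTail (1 / v) r k := by
  have hv0 : 0 < v := by linarith
  have hs0 : 0 ≤ 1 / (2 * v) := by positivity
  have hs1 : 1 / (2 * v) ≤ 1 / 2 := by
    rw [div_le_div_iff₀ (by positivity) (by norm_num)]; linarith
  have hsp : 1 / (2 * v) ≤ 1 / v := one_div_le_one_div_of_le hv0 (by linarith)
  have hp1 : 1 / v ≤ 1 := by rw [div_le_one hv0]; exact hv
  refine le_trans ?_ (le_binTail hs0 hsp hp1 r k)
  have h1 : ((r : ℝ) / 2) ^ k / k.factorial ≤ r.choose k := by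
    rw [div_le_iff₀ (by positivity)]
    have h := Nat.pow_sub_le_descFactorial r k
    rw [Nat.descFactorial_eq_factorial_mul_choose] at h
    have h' : ((r + 1 - k : ℕ) : ℝ) ^ k ≤ k.factorial * r.choose k := by exact_mod_cast h
    have hr : (r : ℝ) / 2 ≤ (r + 1 - k : ℕ) := by
      rw [div_le_iff₀ (by norm_num)]
      exact_mod_cast (by omega : r ≤ (r + 1 - k) * 2)
    calc _ ≤ ((r + 1 - k : ℕ) : ℝ) ^ k := by gcongr
      _ ≤ _ := by rw [mul_comm]; exact h'
  -- With `t = 1 / (2v) ≤ 1 / 2` this is the `r`-th power of a consequence of `(1 + 2t)(1 - t) ≥ 1`.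
  -- Halving the probability keeps it valid at `v = 1`.
  have h2 : Real.exp (-(r / v)) ≤ (1 - 1 / (2 * v)) ^ r := by
    have h3 : Real.exp (-(1 / v)) ≤ 1 - 1 / (2 * v) := by
      have he : 1 + 1 / v ≤ Real.exp (1 / v) := by
        rw [add_comm]; exact Real.add_one_le_exp _
      rw [Real.exp_neg, inv_le_comm₀ (Real.exp_pos _) (by linarith)]
      refine le_trans ?_ he
      rw [inv_le_iff_one_le_mul₀ (by linarith)]
      have : 1 / v = 2 * (1 / (2 * v)) := by field_simp
      rw [this]
      nlinarith
    calc _ = Real.exp (-(1 / v)) ^ r := by rw [← Real.exp_nat_mul]; congr 1; ring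
      _ ≤ _ := by gcongr
  calc _ = ((r : ℝ) / 2) ^ k / k.factorial * (1 / (2 * v)) ^ k * Real.exp (-(r / v)) := by
        rw [div_mul_eq_mul_div, div_mul_eq_mul_div, ← mul_pow, div_mul_eq_mul_div]
        congr 3
        field_simp
        norm_num
    _ ≤ _ := by gcongr

-- The large exponent `B` will pay for the prefactors when `δ₀` is close to 1. The split is on
-- whether `a^k` can absorb both `16384 B` and the loss `exp (-2 C₁ y)`. If not, `k < k₀` and `C₁ y
-- > 1`, so the number of samples per label is at least a constant, as large as desired through
-- `C₀`.
set_option maxHeartbeats 400000 in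
theorem exists_sample_constant {B c : ℝ} (hB : 1 ≤ B) (hc : 0 < c) :
    ∃ C₀ : ℝ, 0 < C₀ ∧ ∀ {d N n k r : ℕ} [NeZero N] {E E' : Ensemble d N} {g g' : Fin N → Fin n}
      {η L y : ℝ}, 0 < n → 1 ≤ k →
      (∀ a, n * (Finset.univ.filter fun i => g i = a).card = N) →
      (∀ a, n * (Finset.univ.filter fun i => g' i = a).card = N) →
      0 < η → η ≤ 8 → 0 < L → 0 < y → y ≤ 1 → y ^ k * ((n : ℝ) ^ 2 * η ^ 2) = k.factorial * L →
      c * k ≤ y * (n : ℝ) ^ 2 → C₀ * (y * (n : ℝ) ^ 2) ≤ r →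
      dataLaw r E E' g g' {x | η / 4 <
          |meanFidelityEst k x - (∑ l, labelFidelity E E' g g' l ^ k) / (n : ℝ) ^ 2|}
        ≤ ENNReal.ofReal (6 * Real.exp (-(B * L))) := by
  set A : ℝ := 16384 * B with hA
  -- The first term makes `a` absorb `A` and the loss `exp (-2)` when `C₁ y ≤ 1`; the second gives
  -- `C₁ c ≥ 2`, hence at least `2k` samples.
  set a : ℝ := A * Real.exp 2 + 1 / c with ha
  set C₁ : ℝ := 4 * a with hC₁
  have he2 : 1 ≤ Real.exp 2 := Real.one_le_exp (by norm_num)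
  have hA1 : 16384 ≤ A := by linarith
  have hc' : 0 < 1 / c := by positivity
  have haA : A * Real.exp 2 ≤ a := by linarith
  have ha2 : 2 ≤ a := by nlinarith
  have hC₁c : 2 ≤ C₁ * c := by
    have : 1 / c * c = 1 := by field_simp
    have : 0 ≤ A * Real.exp 2 * c := by positivity
    nlinarith
  have hC₁0 : 0 < C₁ := by linarith
  obtain ⟨k₀, hk₀⟩ := pow_unbounded_of_one_lt (A * Real.exp (2 * C₁)) (by linarith : 1 < a)
  obtain ⟨D, κ, hκ, hthr⟩ := pexp_labelEst_le_of_threshold hB k₀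
  refine ⟨2 * C₁ * (1 + D + |Real.log κ|), by positivity, ?_⟩
  intro d N n k r _ E E' g g' η L y hn hk hg hg' hη0 hη hL hy0 hy1 hyk hcy hr
  have hn1 : (1 : ℝ) ≤ n := by exact_mod_cast hn
  have hv1 : (1 : ℝ) ≤ (n : ℝ) ^ 2 := one_le_pow₀ hn1
  have hcard : (Fintype.card (Fin n × Fin n) : ℝ) = (n : ℝ) ^ 2 := by
    rw [Fintype.card_prod, Fintype.card_fin]; push_cast; ring
  have hΛ : 0 < Fintype.card (Fin n × Fin n) := by
    rw [Fintype.card_prod, Fintype.card_fin]; positivity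
  have hu0 : ∀ _l : Fin n × Fin n, 0 ≤ 1 / (n : ℝ) ^ 2 := fun _ => by positivity
  have hu1 : ∑ _l : Fin n × Fin n, 1 / (n : ℝ) ^ 2 = 1 := by
    rw [Finset.sum_const, nsmul_eq_mul, Finset.card_univ, hcard]; field_simp
  rw [dataLaw_apply hn hg hg']
  refine ENNReal.ofReal_le_ofReal ?_
  simp only [Set.mem_ofPred_eq, meanFidelityEst_eq_labelEst]
  rw [← hcard] at hv1 hu0 hu1 hyk hcy hr ⊢
  set v : ℝ := (Fintype.card (Fin n × Fin n) : ℝ) with hv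
  have hv0 : 0 < v := by linarith
  have hfact : (1 : ℝ) ≤ k.factorial := by exact_mod_cast Nat.factorial_pos k
  have hk1 : (1 : ℝ) ≤ k := by exact_mod_cast hk
  have hyv : 0 < y * v := by positivity
  have hp0 : 0 ≤ 1 / v := by positivity
  have hp1 : 1 / v ≤ 1 := by rw [div_le_one hv0]; exact hv1
  by_cases hcase : k₀ ≤ k ∨ C₁ * y ≤ 1
  -- The lower bound for the tail carries `exp (-(r / v))` and deteriorates for large `r`. It is
  -- therefore used at `r'`, and monotonicity of the tail transfers it to every `r ≥ r'`.
  · set r' := ⌈C₁ * (y * v)⌉₊ with hr'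
    have h1 : C₁ * (y * v) ≤ r' := Nat.le_ceil _
    have hCk : 2 * (k : ℝ) ≤ C₁ * (y * v) := by
      calc 2 * (k : ℝ) ≤ C₁ * c * k := by gcongr
        _ = C₁ * (c * k) := by ring
        _ ≤ _ := by gcongr
    have h2 : (r' : ℝ) ≤ 2 * (C₁ * (y * v)) := by
      have := Nat.ceil_lt_add_one (a := C₁ * (y * v)) (by positivity)
      rw [← hr'] at this
      linarith
    have hrr : r' ≤ r := by
      have h3 : 2 * (C₁ * (y * v)) ≤ r := by
        refine le_trans ?_ hr
        have : (0 : ℝ) ≤ D + |Real.log κ| := by positivity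
        have h4 : 0 ≤ 2 * C₁ * (y * v) * (D + |Real.log κ|) := by positivity
        nlinarith
      exact_mod_cast h2.trans h3
    have h2k : 2 * k ≤ r' := by exact_mod_cast hCk.trans h1
    set q := binTail (1 / v) r k with hq
    have hqlow : (a * y) ^ k / k.factorial * Real.exp (-(2 * C₁ * y)) ≤ q := by
      refine le_trans ?_ ((le_binTail_one_div hv1 h2k).trans (binTail_mono hp0 hp1 k hrr))
      have e1 : a * y ≤ r' / (4 * v) := by
        rw [le_div_iff₀ (by positivity)]
        calc _ = C₁ * (y * v) := by rw [hC₁]; ring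
          _ ≤ _ := h1
      have e2 : (r' : ℝ) / v ≤ 2 * C₁ * y := by
        rw [div_le_iff₀ hv0]; linarith
      have : 0 ≤ a * y := by positivity
      gcongr
    have hq0 : 0 < q := lt_of_lt_of_le (by positivity) hqlow
    have hmain : A ≤ a ^ k * Real.exp (-(2 * C₁ * y)) := by
      rw [Real.exp_neg, ← div_eq_mul_inv, le_div_iff₀ (Real.exp_pos _)]
      rcases hcase with h | h
      · calc A * Real.exp (2 * C₁ * y) ≤ A * Real.exp (2 * C₁) := by
              refine mul_le_mul_of_nonneg_left (Real.exp_le_exp.2 ?_) (by linarith)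
              nlinarith
          _ ≤ a ^ k₀ := hk₀.le
          _ ≤ a ^ k := pow_le_pow_right₀ (by linarith) h
      · calc A * Real.exp (2 * C₁ * y) ≤ A * Real.exp 2 := by
              refine mul_le_mul_of_nonneg_left (Real.exp_le_exp.2 ?_) (by linarith)
              linarith
          _ ≤ a := haA
          _ ≤ a ^ k := le_self_pow₀ (by linarith) (by omega)
    have hE : 16384 * (B * L) ≤ η ^ 2 * (q * v) := by
      calc 16384 * (B * L) = A * L := by rw [hA]; ring
        _ ≤ a ^ k * Real.exp (-(2 * C₁ * y)) * L := by gcongr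
        _ = a ^ k * Real.exp (-(2 * C₁ * y)) * (y ^ k * (v * η ^ 2) / k.factorial) := by
            rw [hyk]; field_simp
        _ = η ^ 2 * ((a * y) ^ k / k.factorial * Real.exp (-(2 * C₁ * y)) * v) := by
            rw [mul_pow]; ring
        _ ≤ _ := mul_le_mul_of_nonneg_left (mul_le_mul_of_nonneg_right hqlow hv0.le) (sq_nonneg η)
    exact pexp_labelEst_le_of_many hΛ hu0 hu1 outcomeWeight_nonneg
      sum_outcomeWeight outcomeWeight_sub
      (labelFidelity_nonneg E E' g g') (labelFidelity_le_one E E' g g') hk (fun _ => hq.symm)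
      hq0 (binTail_le_one hp0 hp1 r k) hη0 hη hE
  · rw [not_or, not_le, not_le] at hcase
    obtain ⟨hkk, hCy⟩ := hcase
    refine (hthr hΛ hu0 hu1 outcomeWeight_nonneg sum_outcomeWeight
      outcomeWeight_sub (labelFidelity_nonneg E E' g g')
      (labelFidelity_le_one E E' g g') hk hkk.le (fun _ => rfl) hη0 hη ?_).trans ?_
    · refine (one_sub_binTail_le_exp hp0 hp1 r D).trans ?_
      rw [← Real.exp_log hκ, Real.exp_le_exp]
      have h1 : 1 + D + |Real.log κ| ≤ 1 / v * r / 2 := by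
        have h2 : 0 ≤ (1 + D + |Real.log κ|) * v := by positivity
        have h3 : 2 * ((1 + D + |Real.log κ|) * v) ≤ r := by
          refine le_trans ?_ hr
          calc 2 * ((1 + D + |Real.log κ|) * v) = 2 * ((1 + D + |Real.log κ|) * v) * 1 := by ring
            _ ≤ 2 * ((1 + D + |Real.log κ|) * v) * (C₁ * y) := by gcongr
            _ = _ := by ring
        rw [le_div_iff₀ (by norm_num), one_div_mul_eq_div, le_div_iff₀ hv0]
        linarith
      linarith [neg_abs_le (Real.log κ)]
    · have h1 : L ≤ η ^ 2 * v := by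
        have h2 : y ^ k ≤ 1 := pow_le_one₀ hy0.le hy1
        have h3 : 0 ≤ v * η ^ 2 := by positivity
        calc L ≤ k.factorial * L := le_mul_of_one_le_left hL.le hfact
          _ = y ^ k * (v * η ^ 2) := hyk.symm
          _ ≤ v * η ^ 2 := mul_le_of_le_one_left h3 h2
          _ = η ^ 2 * v := mul_comm _ _
      exact mul_le_mul_of_nonneg_left
        (Real.exp_le_exp.2 (neg_le_neg (mul_le_mul_of_nonneg_left h1 (by linarith)))) (by norm_num)

/-- This turns the real powers in the sample bound into the natural-power equation that defines `y`.
-/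
theorem rpow_scale_div {k n : ℕ} (hk : 1 ≤ k) (hn : 0 < n) {K : ℝ} (hK : 0 < K) :
    (K ^ (1 / (k : ℝ)) * (n : ℝ) ^ (2 - 2 / (k : ℝ)) / (n : ℝ) ^ 2) ^ k = K / (n : ℝ) ^ 2 := by
  have hn' : (0 : ℝ) < n := by exact_mod_cast hn
  have hk' : (k : ℝ) ≠ 0 := by exact_mod_cast (by omega : k ≠ 0)
  have e1 : (K ^ (1 / (k : ℝ))) ^ k = K := by
    rw [← Real.rpow_natCast, ← Real.rpow_mul hK.le, one_div_mul_cancel hk', Real.rpow_one]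
  have e2 : ((n : ℝ) ^ (2 - 2 / (k : ℝ))) ^ k = ((n : ℝ) ^ 2) ^ k / (n : ℝ) ^ 2 := by
    have e3 : (2 - 2 / (k : ℝ)) * k = (2 * k : ℕ) - (2 : ℕ) := by
      push_cast; field_simp
    rw [← Real.rpow_natCast _ k, ← Real.rpow_mul hn'.le, e3, Real.rpow_sub hn',
      Real.rpow_natCast, Real.rpow_natCast, pow_mul]
  rw [div_pow, mul_pow, e1, e2]
  field_simp

/-- From `k! ≥ (k / e)^k`: the allowed sample size is at least of order `k`, as U-statistics of
order `k` require. -/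
theorem mul_le_scale {k n : ℕ} (hk : 1 ≤ k) (hn : 0 < n) {c y κ : ℝ} (hc0 : 0 ≤ c)
    (hc1 : c ≤ 1) (hy : 0 ≤ y) (hκ : c * k.factorial ≤ κ)
    (hyk : y ^ k = κ / (n : ℝ) ^ 2) : c * Real.exp (-1) * k ≤ y * (n : ℝ) ^ 2 := by
  have hn1 : (1 : ℝ) ≤ (n : ℝ) ^ 2 := one_le_pow₀ (by exact_mod_cast hn)
  have hn0 : (0 : ℝ) < (n : ℝ) ^ 2 := by linarith
  refine le_of_pow_le_pow_left₀ (by omega : k ≠ 0) (by positivity) ?_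
  have h1 : (Real.exp (-1) * k) ^ k ≤ k.factorial := by
    have h := Real.pow_div_factorial_le_exp (x := (k : ℝ)) (Nat.cast_nonneg k) k
    rw [div_le_iff₀ (by positivity)] at h
    calc _ = Real.exp (-k) * (k : ℝ) ^ k := by
          rw [mul_pow, ← Real.exp_nat_mul]; congr 2; ring
      _ ≤ Real.exp (-k) * (Real.exp k * k.factorial) := by gcongr
      _ = _ := by rw [← mul_assoc, ← Real.exp_add]; simp
  calc (c * Real.exp (-1) * k) ^ k = c ^ k * (Real.exp (-1) * k) ^ k := by
        rw [mul_assoc, mul_pow]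
    _ ≤ c * k.factorial := by
        refine mul_le_mul (pow_le_of_le_one hc0 hc1 (by omega)) h1 (by positivity) hc0
    _ ≤ κ := hκ
    _ = y ^ k * (n : ℝ) ^ 2 := by rw [hyk]; field_simp
    _ ≤ y ^ k * ((n : ℝ) ^ 2) ^ k := by
        refine mul_le_mul_of_nonneg_left (le_self_pow₀ hn1 (by omega)) (by positivity)
    _ = _ := (mul_pow _ _ _).symm

theorem exp_budget {δ L L₀ : ℝ} (hδ : 0 < δ) (hL : L = Real.log (1 / δ)) (hL₀ : 0 < L₀)
    (hLL : L₀ ≤ L) : 6 * Real.exp (-((1 + 18 / L₀) * L)) ≤ δ / 3 := by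
  have h1 : L + 18 ≤ (1 + 18 / L₀) * L := by
    have : 18 ≤ 18 / L₀ * L := by
      rw [div_mul_eq_mul_div, le_div_iff₀ hL₀]; linarith
    linarith
  have h2 : Real.exp (-L) = δ := by
    rw [hL, one_div, Real.log_inv, neg_neg, Real.exp_log hδ]
  have h3 : Real.exp (-18) ≤ 1 / 18 := by
    have := Real.add_one_le_exp (18 : ℝ)
    rw [Real.exp_neg, inv_eq_one_div]
    exact one_div_le_one_div_of_le (by norm_num) (by linarith)
  calc _ ≤ 6 * Real.exp (-L + -18) := by
        gcongr; linarith
    _ = 6 * (δ * Real.exp (-18)) := by rw [Real.exp_add, h2]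
    _ ≤ 6 * (δ * (1 / 18)) := by gcongr
    _ = _ := by ring

/-- Estimator and mean fidelity are both at most 1 in absolute value, so an error above `η / 4 > 2`
is impossible. -/
theorem failureProb_eq_zero {d N n : ℕ} [NeZero N] {k M : ℕ} {ε η β : ℝ} (hβ : 0 ≤ β)
    (hε : ε = η + 4 * β) (hη : 8 < η) (E₁ E₂ : Ensemble d N) (g₁ g₂ : Fin N → Fin n) :
    failureProb k M ε E₁ E₂ g₁ g₂ = 0 := by
  have h0 : ∀ E E' : Ensemble d N, |meanFidelity k E E' - meanFidelity k E E'| ≤ β :=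
    fun _ _ => by simpa using hβ
  have hP : ∀ (E E' : Ensemble d N) (g g' : Fin N → Fin n),
      dataLaw (M / 3) E E' g g' {x | η / 4 < |meanFidelityEst k x - meanFidelity k E E'|} ≤ 0 := by
    intro E E' g g'
    rw [Set.eq_empty_of_forall_notMem (s := {x | _}), MeasureTheory.measure_empty]
    intro x hx
    simp only [Set.mem_ofPred_eq] at hx
    refine absurd hx (not_lt.2 ?_)
    have a := abs_le.1 (abs_meanFidelityEst_le k x)
    have b := meanFidelity_nonneg k E E'
    have c := meanFidelity_le_one k E E'
    rw [abs_le]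
    constructor <;> linarith
  have := failureProb_le hε (h0 _ _) (h0 _ _) (h0 _ _) (hP E₁ E₁ g₁ g₁) (hP E₂ E₂ g₂ g₂)
    (hP E₁ E₂ g₁ g₂)
  simpa using this

end QuantumMMD

/-! ### Assembly of the sample bound. -/

theorem mainTheorem8 (δ₀ : ℝ) (hδ₀ : δ₀ < 1) :
    ∃ C : ℝ, 0 < C ∧
      ∀ (k n : ℕ) (ε εb δ : ℝ), 1 ≤ k → 0 ≤ εb → 0 < δ → δ ≤ δ₀ →
        32 * (k : ℝ) * Real.sqrt εb < ε →
        (k.factorial : ℝ) / (ε - 32 * (k : ℝ) * Real.sqrt εb) ^ 2 * Real.log (1 / δ)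
          ≤ (n : ℝ) ^ 2 →
        ∃ M₀ : ℕ,
          (M₀ : ℝ) ≤ C *
            (((k.factorial : ℝ) / (ε - 32 * (k : ℝ) * Real.sqrt εb) ^ 2 * Real.log (1 / δ))
                ^ (1 / (k : ℝ)) * (n : ℝ) ^ (2 - 2 / (k : ℝ))) ∧
          ∀ (d N : ℕ) [NeZero N] (E₁ E₂ : Ensemble d N)
            (G₁ : BallGrouping E₁ n εb) (G₂ : BallGrouping E₂ n εb) (M : ℕ), M₀ ≤ M →
            failureProb k M ε E₁ E₂ G₁.ball G₂.ball ≤ ENNReal.ofReal δ := by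
  rcases le_or_gt δ₀ 0 with hneg | hpos
  · exact ⟨1, one_pos, fun k n ε εb δ _ _ h1 h2 => absurd (h1.trans_le h2) (not_lt.2 hneg)⟩
  set L₀ := Real.log (1 / δ₀) with hL₀
  have hL₀0 : 0 < L₀ := Real.log_pos (by rwa [one_lt_div hpos])
  have hB : 1 ≤ 1 + 18 / L₀ := by
    have : 0 < 18 / L₀ := by positivity
    linarith
  -- In the case `η ≤ 8` one has `L / η² ≥ L₀ / 64`; the cap at 1 ensures `c^k ≤ c`.
  set c : ℝ := min 1 (L₀ / 64) with hc
  have hc0 : 0 < c := lt_min one_pos (by positivity)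
  have hce : 0 < c * Real.exp (-1) := by positivity
  obtain ⟨C₀, hC₀, htail⟩ := exists_sample_constant hB hce
  refine ⟨3 * C₀ + 3 / (c * Real.exp (-1)), by positivity, ?_⟩
  intro k n ε εb δ hk hεb hδ hδδ₀ hε hn
  set η := ε - 32 * (k : ℝ) * Real.sqrt εb with hη
  set L := Real.log (1 / δ) with hL
  set K := (k.factorial : ℝ) / η ^ 2 * L with hK
  have hη0 : 0 < η := by linarith
  have hLL : L₀ ≤ L := Real.log_le_log (by positivity) (one_div_le_one_div_of_le hδ hδδ₀)
  have hL0 : 0 < L := by linarith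
  have hK0 : 0 < K := by positivity
  have hεη : ε = η + 4 * (8 * k * Real.sqrt εb) := by rw [hη]; ring
  rcases lt_or_ge 8 η with hη8 | hη8
  · refine ⟨0, by rw [Nat.cast_zero]; positivity, fun d N _ E₁ E₂ G₁ G₂ M _ => ?_⟩
    rw [failureProb_eq_zero (by positivity) hεη hη8]
    exact bot_le
  have hn0 : 0 < n := by
    rcases Nat.eq_zero_or_pos n with h | h
    · rw [h] at hn; norm_num at hn; linarith
    · exact h
  have hn' : (0 : ℝ) < n := by exact_mod_cast hn0
  have hnn : (0 : ℝ) < (n : ℝ) ^ 2 := by positivity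
  set X := K ^ (1 / (k : ℝ)) * (n : ℝ) ^ (2 - 2 / (k : ℝ)) with hX
  have hX0 : 0 < X := by positivity
  set y := X / (n : ℝ) ^ 2 with hy
  have hyk : y ^ k = K / (n : ℝ) ^ 2 := rpow_scale_div hk hn0 hK0
  have hyX : y * (n : ℝ) ^ 2 = X := by rw [hy]; field_simp
  have hy0 : 0 < y := by positivity
  have hy1 : y ≤ 1 := by
    rw [← pow_le_one_iff_of_nonneg hy0.le (by omega : k ≠ 0), hyk, div_le_one hnn]
    exact hn
  have hyL : y ^ k * ((n : ℝ) ^ 2 * η ^ 2) = k.factorial * L := by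
    rw [hyk, hK]; field_simp
  have hcK : c * k.factorial ≤ K := by
    have h1 : c ≤ L / η ^ 2 := by
      refine (min_le_right _ _).trans ?_
      rw [div_le_div_iff₀ (by norm_num) (by positivity)]
      have : η ^ 2 ≤ 64 := by nlinarith
      calc L₀ * η ^ 2 ≤ L * 64 := by gcongr
        _ = _ := rfl
    calc _ ≤ L / η ^ 2 * k.factorial := by gcongr
      _ = _ := by rw [hK]; ring
  have hcy := mul_le_scale hk hn0 hc0.le (min_le_left _ _) hy0.le hcK hyk
  refine ⟨⌊(3 * C₀ + 3 / (c * Real.exp (-1))) * X⌋₊, Nat.floor_le (by positivity), ?_⟩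
  intro d N _ E₁ E₂ G₁ G₂ M hM
  -- The floor in `M₀` and the division by 3 lose at most 3 in total, which the second summand of
  -- the constant, worth at least 3, covers.
  have hr : C₀ * (y * (n : ℝ) ^ 2) ≤ (M / 3 : ℕ) := by
    have h1 : (3 * C₀ + 3 / (c * Real.exp (-1))) * X < M + 1 :=
      (Nat.lt_floor_add_one _).trans_le (by exact_mod_cast Nat.add_le_add_right hM 1)
    have h2 : (M : ℝ) ≤ 3 * (M / 3 : ℕ) + 2 := by
      exact_mod_cast (by omega : M ≤ 3 * (M / 3) + 2)
    have h3 : 3 ≤ 3 / (c * Real.exp (-1)) * X := by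
      rw [div_mul_eq_mul_div, le_div_iff₀ hce]
      have hk1 : (1 : ℝ) ≤ k := by exact_mod_cast hk
      have : c * Real.exp (-1) * 1 ≤ c * Real.exp (-1) * k := by gcongr
      linarith
    rw [hyX]
    linarith
  have hbudget := ENNReal.ofReal_le_ofReal (exp_budget hδ hL hL₀0 hLL)
  refine (failureProb_le hεη (abs_meanFidelity_sub_le G₁ G₁ hn0 k)
    (abs_meanFidelity_sub_le G₂ G₂ hn0 k) (abs_meanFidelity_sub_le G₁ G₂ hn0 k)
    ((htail hn0 hk G₁.uniform G₁.uniform hη0 hη8 hL0 hy0 hy1 hyL hcy hr).trans hbudget)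
    ((htail hn0 hk G₂.uniform G₂.uniform hη0 hη8 hL0 hy0 hy1 hyL hcy hr).trans hbudget)
    ((htail hn0 hk G₁.uniform G₂.uniform hη0 hη8 hL0 hy0 hy1 hyL hcy hr).trans hbudget)).trans ?_
  have hδ3 : 0 ≤ δ / 3 := by positivity
  rw [← ENNReal.ofReal_add hδ3 hδ3, ← ENNReal.ofReal_add hδ3 (by positivity)]
  exact ENNReal.ofReal_le_ofReal (by linarith)
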